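/- **Conventions.** Let $[\omega]^{<\omega}$ be the set of finite subsets of $\omega$. For $A\subseteq[\omega]^{<\omega}$ and $n<\omega$ put $A_{\{n\}}=\{s: n<\min s,\ \{n\}\cup s\in A\}$ (with $s=\emptyset$ allowed). For $M\subseteq\omega$, a family $A$ of finite subsets of $M$ is *$\alpha$-uniform on $M$* if either $\alpha=0$ and $A=\{\emptyset\}$; or $\alpha=\beta+1$, $\emptyset\notin A$, and for each $n\in M$ the family $A_{\{n\}}$ is $\beta$-uniform on $M\cap(n,\infty)$; or $\alpha$ is a limit ordinal, $\emptyset\notin A$, and there is a non-decreasing sequence $(\alpha_n)_{n\in M}$ of ordinals below $\alpha$, cofinal in $\alpha$, such that for each $n\in M$ the family $A_{\{n\}}$ is $\alpha_n$-uniform on $M\cap(n,\infty)$. A *uniform barrier of rank $\alpha$* is a family $B\subseteq[\omega]^{<\omega}$ that is $\alpha$-uniform on $\omega$, has no two members one of which is a proper subset of the other, and contains an initial segment of every infinite $X\subseteq\omega$. Identify $b=\{b_0<b_1<\dots<b_j\}\in B$ with the non-decreasing sequence $(b_0,b_1-1,\dots,b_j-j)$; let $F_B$ be the set of sequences obtained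 from $B$, and $\widehat F_B$ the set of their initial segments. Order finite sequences of natural numbers by $\prec$: the empty sequence is least, and nonempty sequences are compared first by last entry and then lexicographically (proper initial segments being lexicographically smaller). *The ideals.* On the one-point set $\{()\}$ the ideal is $\{\emptyset\}$. On a set $F\ne\{()\}$ of the form $F_B$, or the set of all sequences of a fixed length $k\geq 1$, $X\subseteq F$ belongs to the ideal ($\mathrm{Fin}^{B}$, respectively $\mathrm{Fin}^{\otimes k}$) iff for all but finitely many $n$ the section $\{s: n^\frown s\in X\}$ belongs to the ideal, defined in the same way, on $\{s: n^\frown s\in F\}$. Write $X\le^*Y$ iff $X\setminus Y$ belongs to the ideal. *The spaces.* $\mathcal E_2$ is the set of all $f[\omega^{\not\downarrow 2}]$, where $\omega^{\not\downarrow 2}$ is the set of non-decreasing sequences of length $2$, and $f$ is a map of the set of all non-decreasing sequences of length at most $2$ into itself preserving $\prec$ and proper initial segments. $\mathcal E_B$ is the set of all $X=\{f(s): s\in D,\ f(s)\in F_B\}$, where $D$ is a tree of finite non-decreasing sequences containing $()$, $f:D\to\widehat F_B$ preserves length, $\prec$ and proper initial segments, and for each $s\in D$: if $f(s)\in F_B$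 then $s$ has no proper extension in $D$, and if $f(s)\notin F_B$ then the immediate successors of $s$ in $D$ are all the non-decreasing sequences $s^\frown m$. *Tower numbers.* For a set $\mathcal R$ with a quasi-order $\le^*$, a *tower* is a family $\mathcal F\subseteq\mathcal R$ that is linearly ordered by $\geq^*$ and has no pseudointersection, i.e. there is no $Z\in\mathcal R$ with $Z\le^*X$ for all $X\in\mathcal F$; $\mathfrak t_{\mathcal R}$ is the smallest cardinality of a tower of $(\mathcal R,\le^*)$. **Theorem.** Let $B$ be a uniform barrier of countable rank $\alpha\ge 2$ ($\alpha$ may be infinite). Then $\mathfrak t_{\mathcal E_B}\le\mathfrak t_{\mathcal E_2}$, and $\mathfrak t_{\mathcal E_B}=\omega_1$. Moreover, the forcing $\mathcal P(F_B)/\mathrm{Fin}^{B}$ (that is, $\mathcal P(\omega^\alpha)/\mathrm{Fin}^{\otimes\alpha}$, realized on the barrier $B$ of rank $\alpha$) has tower number $\omega_1$: the smallest cardinality of a tower of the $\mathrm{Fin}^{B}$-positive subsets of $F_B$ under $\le^*$ is $\omega_1$. -/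

import Mathlib

/-! ### Towers -/

/-- `𝓕` is a tower of the quasi-order `(R, le)`, where `R` is a set of conditions: it is linearly
ordered by `le` and has no pseudointersection, i.e. no lower bound in `R`. -/
def IsTower {P : Type} (R : Set P) (le : P → P → Prop) (𝓕 : Set P) : Prop :=
  𝓕 ⊆ R ∧ (∀ X ∈ 𝓕, ∀ Y ∈ 𝓕, le X Y ∨ le Y X) ∧ ¬ ∃ Z ∈ R, ∀ X ∈ 𝓕, le Z X

/-- The tower number of `(R, le)`: the least cardinality of a tower. -/
noncomputable def towerNumber {P : Type} (R : Set P) (le : P → P → Prop) : Cardinal.{0} :=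
  sInf {κ | ∃ 𝓕 : Set P, IsTower R le 𝓕 ∧ Cardinal.mk 𝓕 = κ}

/-! ### Uniform barriers on `ω` -/

/-- `b` is a (finite) initial segment of the set `X` of natural numbers. -/
def IsInitSeg (b : Finset ℕ) (X : Set ℕ) : Prop :=
  ∃ n : ℕ, (b : Set ℕ) = X ∩ Set.Iio n

/-- `B` is a barrier on `ω`: no member is a proper subset of another one, and every infinite set
of natural numbers has an initial segment in `B`. -/
def IsBarrier (B : Set (Finset ℕ)) : Prop :=
  (∀ b ∈ B, ∀ c ∈ B, b ⊆ c → b = c) ∧ ∀ X : Set ℕ, X.Infinite → ∃ b ∈ B, IsInitSeg b X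

/-- `A_{n} = {s : n < min s and {n} ∪ s ∈ A}`. -/
def familySection (A : Set (Finset ℕ)) (n : ℕ) : Set (Finset ℕ) :=
  {s | (∀ x ∈ s, n < x) ∧ insert n s ∈ A}

/-- `IsUniformOn α M A`: the family `A` of finite subsets of `M` is `α`-uniform on `M`, that is,
uniform of rank `α`. -/
inductive IsUniformOn : Ordinal.{0} → Set ℕ → Set (Finset ℕ) → Prop
  | zero (M : Set ℕ) : IsUniformOn 0 M {∅}
  | succ (β : Ordinal.{0}) (M : Set ℕ) (A : Set (Finset ℕ))
      (hA : ∀ s ∈ A, (s : Set ℕ) ⊆ M) (h0 : ∅ ∉ A)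
      (h : ∀ n ∈ M, IsUniformOn β (M ∩ Set.Ioi n) (familySection A n)) :
      IsUniformOn (Order.succ β) M A
  | limit (α : Ordinal.{0}) (hα : Order.IsSuccLimit α) (M : Set ℕ) (A : Set (Finset ℕ))
      (hA : ∀ s ∈ A, (s : Set ℕ) ⊆ M) (h0 : ∅ ∉ A)
      (a : ℕ → Ordinal.{0}) (hmono : MonotoneOn a M)
      (hlt : ∀ n ∈ M, a n < α) (hcof : ∀ β < α, ∃ n ∈ M, β < a n)
      (h : ∀ n ∈ M, IsUniformOn (a n) (M ∩ Set.Ioi n) (familySection A n)) :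
      IsUniformOn α M A

/-- `B` is a uniform barrier (on `ω`) of rank `α`. -/
def IsUniformBarrier (α : Ordinal.{0}) (B : Set (Finset ℕ)) : Prop :=
  IsBarrier B ∧ IsUniformOn α Set.univ B

/-! ### Non-decreasing sequences and the well-order `≺` -/

/-- The non-decreasing sequences of natural numbers of length at most `k`. -/
def nondecLE (k : ℕ) : Set (List ℕ) := {s | s.Pairwise (· ≤ ·) ∧ s.length ≤ k}

/-- The non-decreasing sequences of natural numbers of length `k`. -/
def nondecEq (k : ℕ) : Set (List ℕ) := {s | s.Pairwise (· ≤ ·) ∧ s.length = k}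

/-- `s` is a proper initial segment of `t`. -/
def ProperInit (s t : List ℕ) : Prop := s <+: t ∧ s ≠ t

/-- The order `≺` on finite sequences: the empty sequence comes first; nonempty sequences are
compared first by their last entry, and then lexicographically (a proper initial segment being
lexicographically smaller). -/
def Prec (s t : List ℕ) : Prop :=
  t ≠ [] ∧ (s = [] ∨ s.getLastD 0 < t.getLastD 0 ∨
    (s.getLastD 0 = t.getLastD 0 ∧ List.Lex (· < ·) s t))

/-- The non-decreasing sequence `(b₀, b₁ - 1, b₂ - 2, …)` that corresponds to the finite set
`b = {b₀ < b₁ < b₂ < …}`. (Here `bᵢ ≥ i`, so that the subtraction is never truncated.) -/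
def nondecOf (b : Finset ℕ) : List ℕ := (b.sort (· ≤ ·)).mapIdx fun i x => x - i

/-- The set of non-decreasing sequences that corresponds to the family `B`; for `B = [ω]^k` this
is the set of all non-decreasing sequences of length `k`. -/
def nondecFamily (B : Set (Finset ℕ)) : Set (List ℕ) := nondecOf '' B

/-- All initial segments of members of `F`. -/
def initSegs (F : Set (List ℕ)) : Set (List ℕ) := {s | ∃ t ∈ F, s <+: t}

/-! ### The ideals `Fin^{⊗k}` and `Fin^B` -/

/-- The ideal `Fin^{⊗k}` on sequences of length `k`, and `Fin^B` on the sequences corresponding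
to a uniform barrier `B`. On the one-point set `{()}` of rank `0` it is `{∅}`, and in positive
rank `X` belongs to the ideal if and only if for all but finitely many `n` the section
`{s : n⌢s ∈ X}` belongs to the ideal one step below. -/
inductive FinNull : Set (List ℕ) → Prop
  | empty : FinNull ∅
  | step (X : Set (List ℕ)) (h0 : [] ∉ X) (E : Finset ℕ)
      (h : ∀ n ∉ E, FinNull {s | n :: s ∈ X}) : FinNull X

/-- The quasi-order `X ⊆ Y` modulo the ideal. -/
def AlmostSub (X Y : Set (List ℕ)) : Prop := FinNull (X \ Y)

/-! ### The Ellentuck spaces -/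

/-- The finite dimensional Ellentuck space `𝓔_k`: the images of the set of all non-decreasing
sequences of length `k` under the maps of the non-decreasing sequences of length at most `k` into
themselves that preserve `≺` and proper initial segments. -/
def EllentuckFin (k : ℕ) : Set (Set (List ℕ)) :=
  {X | ∃ f : List ℕ → List ℕ,
    (∀ s ∈ nondecLE k, f s ∈ nondecLE k) ∧
    (∀ s ∈ nondecLE k, ∀ t ∈ nondecLE k, Prec s t → Prec (f s) (f t)) ∧
    (∀ s ∈ nondecLE k, ∀ t ∈ nondecLE k, ProperInit s t → ProperInit (f s) (f t)) ∧
    X = f '' nondecEq k}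

/-- `f`, defined on the tree `D` of non-decreasing sequences, is an `𝓔`-tree for the set `F` of
maximal nodes: it maps `D` into the tree of initial segments of members of `F`, preserves length,
`≺` and proper initial segments, and `s ∈ D` has either no successors in `D` (when `f s` is
maximal) or else all successors that keep the sequence non-decreasing. When `F` is the set of
all non-decreasing sequences of length `k`, necessarily `D = nondecLE k`. -/
structure IsETree (F D : Set (List ℕ)) (f : List ℕ → List ℕ) : Prop where
  nil_mem : [] ∈ D
  concat_mem : ∀ (s : List ℕ) (m : ℕ), s ++ [m] ∈ D ↔ s ∈ D ∧ f s ∉ F ∧ ∀ x ∈ s, x ≤ m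
  maps : ∀ s ∈ D, f s ∈ initSegs F
  length_eq : ∀ s ∈ D, (f s).length = s.length
  prec : ∀ s ∈ D, ∀ t ∈ D, Prec s t → Prec (f s) (f t)
  init : ∀ s ∈ D, ∀ t ∈ D, ProperInit s t → ProperInit (f s) (f t)

/-- The Ellentuck space with set `F` of maximal nodes: the sets of maximal nodes in the ranges
of the `𝓔`-trees for `F`. -/
def EllentuckOn (F : Set (List ℕ)) : Set (Set (List ℕ)) :=
  {X | ∃ (D : Set (List ℕ)) (f : List ℕ → List ℕ),
    IsETree F D f ∧ X = f '' {s | s ∈ D ∧ f s ∈ F}}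

/-- The Ellentuck space `𝓔_B` of a uniform barrier `B`. -/
def EllentuckBarrier (B : Set (Finset ℕ)) : Set (Set (List ℕ)) := EllentuckOn (nondecFamily B)

/-- The nonzero conditions of `𝒫(B)/Fin^B`, with `B` written as a set of non-decreasing
sequences. -/
def FinPositive (B : Set (Finset ℕ)) : Set (Set (List ℕ)) :=
  {X | X ⊆ nondecFamily B ∧ ¬ FinNull X}

/-! All three values come from one statement, `towerNumber_eq_aleph_one`: let `F` be a positive set
of sequences that omits the empty one and has finitely many members of length one, and let `R` be a
family of positive subsets of `F` that is dense, i.e. every positive subset of `F` contains a member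
of `R`. Then the tower number of `R` is `ℵ₁`.

No tower is countable, by diagonalization (`exists_lowerBound`): sections of members of the chain,
taken at increasing first entries, are glued together. For a tower of length `ω₁`, fix an operation
`C` giving each positive `W` without the empty sequence `ℵ₁` positive parts `C δ W` with negligible
pairwise intersections. Build a decreasing sequence `Y δ` so that each nonempty section of `Y δ`
lies in `C δ W`, where `W` is the section at the same `n` of `F` or of some earlier `Y ξ`. Then a
positive set is almost contained in the `n`-th section of only countably many `Y δ`
(`countable_setOf_almostSub_consSection`). A pseudointersection would have, for each `δ`, a positive
section almost contained in that of `Y δ`; with countably many `n` available this is impossible.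

It remains to see that the Ellentuck spaces are dense families of positive sets. This holds over any
front (`IsFront.pos_of_mem_ellentuckOn`, `IsFront.exists_ellentuckOn_subset`), and a barrier yields
a front (`IsBarrier.isFront`). Rank at least `2` serves to bound the members of size at most one. -/

/-! ### The ideals -/

/-- The section of a set of sequences at a first entry `n`. -/
def consSection (X : Set (List ℕ)) (n : ℕ) : Set (List ℕ) := {s | n :: s ∈ X}

theorem mem_consSection {X : Set (List ℕ)} {n : ℕ} {s : List ℕ} :
    s ∈ consSection X n ↔ n :: s ∈ X := Iff.rfl

theorem finNull_iff {X : Set (List ℕ)} :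
    FinNull X ↔ [] ∉ X ∧ {n | ¬ FinNull (consSection X n)}.Finite := by
  constructor
  · rintro (_ | ⟨_, h0, E, h⟩)
    · refine ⟨fun h => h, ?_⟩
      have : {n | ¬ FinNull (consSection ∅ n)} = ∅ := by
        ext n
        simpa [consSection] using FinNull.empty
      rw [this]
      exact Set.finite_empty
    · refine ⟨h0, E.finite_toSet.subset fun n hn => ?_⟩
      by_contra hE
      exact hn (h n hE)
  · rintro ⟨h0, h⟩
    refine FinNull.step X h0 h.toFinset fun n hn => ?_
    rwa [Set.Finite.mem_toFinset, Set.mem_ofPred_eq, not_not] at hn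

theorem FinNull.mono {X Y : Set (List ℕ)} (hX : FinNull X) (h : Y ⊆ X) : FinNull Y := by
  induction hX generalizing Y with
  | empty => rw [Set.subset_empty_iff.1 h]; exact FinNull.empty
  | step X h0 E _ ih =>
    exact FinNull.step Y (fun hY => h0 (h hY)) E fun n hn => ih n hn fun s hs => h hs

theorem FinNull.union {X Y : Set (List ℕ)} (hX : FinNull X) (hY : FinNull Y) :
    FinNull (X ∪ Y) := by
  induction hX generalizing Y with
  | empty => simpa using hY
  | step X h0 E h ih =>
    rw [finNull_iff] at hY
    refine finNull_iff.2 ⟨fun hm => hm.elim h0 hY.1,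
      (E.finite_toSet.union hY.2).subset fun n hn => ?_⟩
    by_contra hE
    simp only [Set.mem_union, Finset.mem_coe, Set.mem_ofPred_eq, not_or, not_not] at hE
    exact hn (ih n hE.1 hE.2)

theorem AlmostSub.of_subset {X Y : Set (List ℕ)} (h : X ⊆ Y) : AlmostSub X Y := by
  rw [AlmostSub, Set.sdiff_eq_empty.2 h]
  exact FinNull.empty

theorem AlmostSub.trans {X Y Z : Set (List ℕ)} (h : AlmostSub X Y) (h' : AlmostSub Y Z) :
    AlmostSub X Z :=
  (FinNull.union h h').mono fun s hs => by
    by_cases hY : s ∈ Y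
    · exact Or.inr ⟨hY, hs.2⟩
    · exact Or.inl ⟨hs.1, hY⟩

theorem AlmostSub.finNull {X Y : Set (List ℕ)} (h : AlmostSub X Y) (hY : FinNull Y) :
    FinNull X :=
  (FinNull.union h hY).mono fun s hs => by
    by_cases hs' : s ∈ Y
    · exact Or.inr hs'
    · exact Or.inl ⟨hs, hs'⟩

theorem infinite_setOf_consSection {X : Set (List ℕ)} (h0 : [] ∉ X) (hX : ¬ FinNull X) :
    {n | ¬ FinNull (consSection X n)}.Infinite := fun h => hX (finNull_iff.2 ⟨h0, h⟩)

theorem AlmostSub.finite_setOf_consSection {X Y : Set (List ℕ)} (h : AlmostSub X Y) :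
    {n | ¬ AlmostSub (consSection X n) (consSection Y n)}.Finite := (finNull_iff.1 h).2

theorem countable_iff_mk_lt_aleph_one {I : Type} {s : Set I} :
    s.Countable ↔ Cardinal.mk s < Cardinal.aleph 1 := by
  rw [← Cardinal.le_aleph0_iff_set_countable, ← Order.lt_succ_iff, Cardinal.succ_aleph0]

/-! ### Almost disjoint families -/

/-- Branches of the binary tree: distinct `0`-`1` sequences share only finitely many initial
segments. -/
theorem exists_almostDisjoint_nat {I : Type} (hI : Cardinal.mk I ≤ Cardinal.aleph 1) :
    ∃ A : I → Set ℕ, (∀ i, (A i).Infinite) ∧ ∀ i j, i ≠ j → (A i ∩ A j).Finite := by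
  have h : Cardinal.mk I ≤ Cardinal.mk (ℕ → Bool) := by
    simpa using hI.trans Cardinal.aleph_one_le_continuum
  obtain ⟨x⟩ := h
  let c : I → ℕ → ℕ := fun i n => Encodable.encode (List.ofFn fun k : Fin n => x i k)
  have hc : ∀ i j n m, c i n = c j m → n = m ∧ ∀ k < n, x i k = x j k := by
    intro i j n m h
    have h1 := Encodable.encode_injective h
    have h2 : n = m := by simpa using congrArg List.length h1
    subst h2
    refine ⟨rfl, fun k hk => ?_⟩
    exact congrFun (List.ofFn_injective h1) ⟨k, hk⟩
  refine ⟨fun i => Set.range (c i), fun i => Set.infinite_range_of_injective fun n m h =>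
    (hc i i n m h).1, fun i j hij => ?_⟩
  obtain ⟨k, hk⟩ : ∃ k, x i k ≠ x j k := by
    by_contra! hk
    exact hij (x.injective (funext hk))
  refine ((Set.finite_Iic k).image (c i)).subset ?_
  rintro _ ⟨⟨n, rfl⟩, ⟨m, hm⟩⟩
  refine ⟨n, ?_, rfl⟩
  by_contra hn
  exact hk ((hc i j n m hm.symm).2 k (by simpa using hn))

/-- Every positive set `W` without the empty sequence can be split, uniformly in `W`, into `ℵ₁`
many positive sets with pairwise negligible intersections. -/
theorem exists_almostDisjoint_finNull {I : Type} (hI : Cardinal.mk I ≤ Cardinal.aleph 1) :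
    ∃ C : I → Set (List ℕ) → Set (List ℕ), (∀ i W, C i W ⊆ W) ∧
      (∀ i W, [] ∉ W → ¬ FinNull W → ¬ FinNull (C i W)) ∧
      ∀ i j W, i ≠ j → FinNull (C i W ∩ C j W) := by
  obtain ⟨A, hA, hAd⟩ := exists_almostDisjoint_nat hI
  let J : Set (List ℕ) → ℕ → Prop := fun W n => ¬ FinNull (consSection W n)
  -- `e W` enumerates the first entries at which `W` has a positive section; the almost disjoint
  -- sets are copied along it.
  let e : Set (List ℕ) → ℕ → ℕ := fun W => Nat.nth (J W)
  refine ⟨fun i W => {s | s ∈ W ∧ ∃ a ∈ A i, ∃ u, s = e W a :: u}, fun i W s hs => hs.1, ?_, ?_⟩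
  · intro i W h0 hW hC
    have hJ : {n | J W n}.Infinite := infinite_setOf_consSection h0 hW
    have hinj : Function.Injective (e W) := Nat.nth_injective hJ
    refine ((hA i).image hinj.injOn) ((finNull_iff.1 hC).2.subset ?_)
    rintro _ ⟨a, ha, rfl⟩ hnull
    have : J W (e W a) := Nat.nth_mem_of_infinite hJ a
    exact this (hnull.mono fun s hs => ⟨hs, a, ha, s, rfl⟩)
  · intro i j W hij
    refine finNull_iff.2 ⟨fun h => by simpa using h.1.2, ?_⟩
    by_cases hJ : {n | J W n}.Infinite
    · have hinj : Function.Injective (e W) := Nat.nth_injective hJ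
      refine ((hAd i j hij).image (e W)).subset fun n hn => ?_
      have hne : (consSection ({s | s ∈ W ∧ ∃ a ∈ A i, ∃ u, s = e W a :: u} ∩
          {s | s ∈ W ∧ ∃ a ∈ A j, ∃ u, s = e W a :: u}) n).Nonempty := by
        by_contra hne
        rw [Set.not_nonempty_iff_eq_empty] at hne
        exact hn (by rw [hne]; exact FinNull.empty)
      obtain ⟨s, ⟨-, a, ha, u, hu⟩, ⟨-, b, hb, v, hv⟩⟩ := hne
      rw [List.cons.injEq] at hu hv
      have hab : a = b := hinj (hu.1.symm.trans hv.1)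
      exact ⟨a, ⟨ha, hab ▸ hb⟩, hu.1.symm⟩
    -- With finitely many positive sections, any part of `W` without the empty sequence is already
    -- negligible.
    · refine (Set.not_infinite.1 hJ).subset fun n hn hnull => hn ?_
      exact hnull.mono fun s hs => hs.1.1

/-! ### Lower bounds of countable chains -/

section Towers

variable {F : Set (List ℕ)} {R : Set (Set (List ℕ))}

/-- The enumeration of a chain need not be decreasing; the least of the first `k + 1` terms replaces
the `k`-th term. -/
theorem exists_lowerBound_index {P : Type*} {le : P → P → Prop} (hr : ∀ x, le x x)
    (ht : ∀ x y z, le x y → le y z → le x z) (x : ℕ → P)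
    (hx : ∀ i j, le (x i) (x j) ∨ le (x j) (x i)) (k : ℕ) :
    ∃ j, ∀ i ≤ k, le (x j) (x i) := by
  induction k with
  | zero => exact ⟨0, fun i hi => by rw [Nat.le_zero.1 hi]; exact hr _⟩
  | succ k ih =>
    obtain ⟨j, hj⟩ := ih
    rcases hx j (k + 1) with h | h
    · refine ⟨j, fun i hi => ?_⟩
      rcases Nat.le_succ_iff.1 hi with hi | rfl
      exacts [hj i hi, h]
    · refine ⟨k + 1, fun i hi => ?_⟩
      rcases Nat.le_succ_iff.1 hi with hi | rfl
      exacts [ht _ _ _ h (hj i hi), hr _]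

/-- A countable chain of positive sets has a lower bound in a dense family, each of whose sections
may be taken inside a prescribed positive part `C W` of a section `W` of a member of the chain. -/
theorem exists_lowerBound (h0 : [] ∉ F) (h1 : {n | [n] ∈ F}.Finite)
    (hR : ∀ X ⊆ F, ¬ FinNull X → ∃ Y ∈ R, Y ⊆ X) (X : ℕ → Set (List ℕ))
    (hXF : ∀ i, X i ⊆ F) (hXpos : ∀ i, ¬ FinNull (X i))
    (hX : ∀ i j, AlmostSub (X i) (X j) ∨ AlmostSub (X j) (X i))
    (C : Set (List ℕ) → Set (List ℕ)) (hC : ∀ W, C W ⊆ W)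
    (hCpos : ∀ W, [] ∉ W → ¬ FinNull W → ¬ FinNull (C W)) :
    ∃ Z ∈ R, (∀ i, AlmostSub Z (X i)) ∧
      ∀ n, consSection Z n = ∅ ∨ ∃ i, consSection Z n ⊆ C (consSection (X i) n) := by
  choose μ hμ using exists_lowerBound_index (le := AlmostSub)
    (fun x => AlmostSub.of_subset subset_rfl) (fun _ _ _ => AlmostSub.trans) X hX
  -- Excluding `[n] ∈ F` keeps the empty sequence out of the section, so that `C` gives a positive
  -- part of it.
  have hfreq : ∀ k, ∃ᶠ n in Filter.atTop, [n] ∉ F ∧ ¬ FinNull (consSection (X (μ k)) n) ∧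
      ∀ i ≤ k, AlmostSub (consSection (X (μ k)) n) (consSection (X i) n) := by
    intro k
    rw [Nat.frequently_atTop_iff_infinite]
    have hbad : ({n | [n] ∈ F} ∪ ⋃ i ∈ Set.Iic k,
        {n | ¬ AlmostSub (consSection (X (μ k)) n) (consSection (X i) n)}).Finite :=
      h1.union ((Set.finite_Iic k).biUnion fun i hi => (hμ k i hi).finite_setOf_consSection)
    have hinf := infinite_setOf_consSection (fun h => h0 (hXF _ h)) (hXpos (μ k))
    refine (hinf.sdiff hbad).mono fun n hn => ⟨fun h => hn.2 (Or.inl h), hn.1, fun i hi => ?_⟩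
    by_contra h
    exact hn.2 (Or.inr (Set.mem_biUnion (x := i) hi h))
  obtain ⟨ν, hν, hνp⟩ := Filter.extraction_forall_of_frequently hfreq
  -- The diagonal set. Its section at `ν k` is almost contained in that of `X i` once `i ≤ k`, so
  -- only finitely many sections are bad for a given `i`.
  let Z₀ : Set (List ℕ) := {s | ∃ k u, s = ν k :: u ∧ u ∈ C (consSection (X (μ k)) (ν k))}
  have hsec : ∀ k, consSection Z₀ (ν k) = C (consSection (X (μ k)) (ν k)) := by
    intro k
    ext s
    constructor
    · rintro ⟨k', u, h, hu⟩
      rw [List.cons.injEq] at h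
      obtain rfl := hν.injective h.1
      rwa [h.2]
    · exact fun hs => ⟨k, s, rfl, hs⟩
  have hsec' : ∀ n, n ∉ Set.range ν → consSection Z₀ n = ∅ := by
    intro n hn
    refine Set.eq_empty_of_forall_notMem ?_
    rintro s ⟨k, u, h, -⟩
    rw [List.cons.injEq] at h
    exact hn ⟨k, h.1.symm⟩
  have hZF : Z₀ ⊆ F := by
    rintro _ ⟨k, u, rfl, hu⟩
    exact hXF (μ k) (mem_consSection.1 (hC _ hu))
  have hZ0 : [] ∉ Z₀ := fun h => h0 (hZF h)
  have hZpos : ¬ FinNull Z₀ := by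
    intro h
    refine (Set.infinite_range_of_injective hν.injective) ((finNull_iff.1 h).2.subset ?_)
    rintro _ ⟨k, rfl⟩
    rw [Set.mem_ofPred_eq, hsec]
    exact hCpos _ (fun h => (hνp k).1 (hXF _ h)) (hνp k).2.1
  obtain ⟨Z, hZR, hZ⟩ := hR Z₀ hZF hZpos
  refine ⟨Z, hZR, fun i => (AlmostSub.of_subset hZ).trans ?_, fun n => ?_⟩
  · refine finNull_iff.2 ⟨fun h => hZ0 h.1, ((Set.finite_Iio i).image ν).subset fun n hn => ?_⟩
    by_cases hnr : n ∈ Set.range ν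
    · obtain ⟨k, rfl⟩ := hnr
      refine ⟨k, ?_, rfl⟩
      by_contra hk
      refine hn (FinNull.mono ((hνp k).2.2 i (by simpa using hk)) ?_)
      rintro s ⟨hs, hs'⟩
      have : s ∈ consSection Z₀ (ν k) := hs
      rw [hsec] at this
      exact ⟨hC _ this, hs'⟩
    · refine absurd (FinNull.empty.mono ?_) hn
      rintro s ⟨hs, -⟩
      rw [← hsec' n hnr]
      exact hs
  · by_cases hnr : n ∈ Set.range ν
    · obtain ⟨k, rfl⟩ := hnr
      refine Or.inr ⟨μ k, ?_⟩
      rw [← hsec]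
      exact fun s hs => hZ hs
    · refine Or.inl (Set.subset_empty_iff.1 ?_)
      rw [← hsec' n hnr]
      exact fun s hs => hZ hs

/-! ### The tower number of a dense family -/

theorem IsTower.aleph_one_le (h0 : [] ∉ F) (h1 : {n | [n] ∈ F}.Finite) (hF : ¬ FinNull F)
    (hRF : ∀ X ∈ R, X ⊆ F ∧ ¬ FinNull X) (hR : ∀ X ⊆ F, ¬ FinNull X → ∃ Y ∈ R, Y ⊆ X)
    {T : Set (Set (List ℕ))} (hT : IsTower R AlmostSub T) :
    Cardinal.aleph 1 ≤ Cardinal.mk T := by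
  by_contra hlt
  have hc : T.Countable := countable_iff_mk_lt_aleph_one.2 (not_le.1 hlt)
  obtain ⟨hTR, hchain, hno⟩ := hT
  rcases T.eq_empty_or_nonempty with rfl | hne
  · obtain ⟨Y, hY, -⟩ := hR F subset_rfl hF
    exact hno ⟨Y, hY, by simp⟩
  · obtain ⟨X, rfl⟩ := hc.exists_eq_range hne
    have hm : ∀ i, X i ∈ Set.range X := fun i => ⟨i, rfl⟩
    obtain ⟨Z, hZR, hZ, -⟩ := exists_lowerBound h0 h1 hR X (fun i => (hRF _ (hTR (hm i))).1)
      (fun i => (hRF _ (hTR (hm i))).2) (fun i j => hchain _ (hm i) _ (hm j)) id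
      (fun _ => subset_rfl) (fun _ _ h => h)
    refine hno ⟨Z, hZR, ?_⟩
    rintro _ ⟨i, rfl⟩
    exact hZ i

/-- `Y δ` is a legitimate continuation of `Y ξ`, `ξ < δ`. -/
structure TowerStep {I : Type} [LinearOrder I] (F : Set (List ℕ)) (R : Set (Set (List ℕ)))
    (C : I → Set (List ℕ) → Set (List ℕ)) (δ : I) (Y : ∀ ξ, ξ < δ → Set (List ℕ))
    (Z : Set (List ℕ)) : Prop where
  mem : Z ∈ R
  almostSub : ∀ ξ hξ, AlmostSub Z (Y ξ hξ)
  section_subset : ∀ n, consSection Z n = ∅ ∨ consSection Z n ⊆ C δ (consSection F n) ∨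
    ∃ ξ hξ, consSection Z n ⊆ C δ (consSection (Y ξ hξ) n)

theorem exists_towerStep {I : Type} [LinearOrder I] (h0 : [] ∉ F) (h1 : {n | [n] ∈ F}.Finite)
    (hF : ¬ FinNull F) (hRF : ∀ X ∈ R, X ⊆ F ∧ ¬ FinNull X)
    (hR : ∀ X ⊆ F, ¬ FinNull X → ∃ Y ∈ R, Y ⊆ X)
    {C : I → Set (List ℕ) → Set (List ℕ)} (hC : ∀ i W, C i W ⊆ W)
    (hCpos : ∀ i W, [] ∉ W → ¬ FinNull W → ¬ FinNull (C i W))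
    (δ : I) (hδ : (Set.Iio δ).Countable) (Y : ∀ ξ, ξ < δ → Set (List ℕ))
    (hY : ∀ ξ hξ, Y ξ hξ ∈ R)
    (hdec : ∀ ξ η hξ hη, AlmostSub (Y ξ hξ) (Y η hη) ∨ AlmostSub (Y η hη) (Y ξ hξ)) :
    ∃ Z, TowerStep F R C δ Y Z := by
  have : Countable (Set.Iio δ) := hδ.to_subtype
  obtain ⟨e, he⟩ := exists_surjective_nat (Option (Set.Iio δ))
  -- Adjoining `F` as a top element keeps the chain nonempty when `δ` is least.
  let V : Option (Set.Iio δ) → Set (List ℕ) := fun o => o.elim F fun ξ => Y ξ.1 ξ.2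
  have hV : ∀ o, V o ⊆ F ∧ ¬ FinNull (V o) := by
    rintro (_ | ⟨ξ, hξ⟩)
    exacts [⟨subset_rfl, hF⟩, hRF _ (hY ξ hξ)]
  have hVc : ∀ o p, AlmostSub (V o) (V p) ∨ AlmostSub (V p) (V o) := by
    rintro (_ | ⟨ξ, hξ⟩) (_ | ⟨η, hη⟩)
    · exact Or.inl (AlmostSub.of_subset subset_rfl)
    · exact Or.inr (AlmostSub.of_subset (hV _).1)
    · exact Or.inl (AlmostSub.of_subset (hV _).1)
    · exact hdec ξ η hξ hη
  obtain ⟨Z, hZR, hZ, hZs⟩ := exists_lowerBound h0 h1 hR (fun i => V (e i))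
    (fun i => (hV _).1) (fun i => (hV _).2) (fun i j => hVc _ _) (C δ) (hC δ) (hCpos δ)
  refine ⟨Z, hZR, fun ξ hξ => ?_, fun n => ?_⟩
  · obtain ⟨i, hi⟩ := he (some ⟨ξ, hξ⟩)
    have h := hZ i
    rw [hi] at h
    exact h
  · refine (hZs n).imp_right ?_
    rintro ⟨i, hi⟩
    generalize e i = o at hi
    rcases o with _ | ⟨ξ, hξ⟩
    exacts [Or.inl hi, Or.inr ⟨ξ, hξ, hi⟩]

theorem exists_towerStep_sequence {I : Type} [LinearOrder I] [WellFoundedLT I] (h0 : [] ∉ F)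
    (h1 : {n | [n] ∈ F}.Finite)
    (hF : ¬ FinNull F) (hRF : ∀ X ∈ R, X ⊆ F ∧ ¬ FinNull X)
    (hR : ∀ X ⊆ F, ¬ FinNull X → ∃ Y ∈ R, Y ⊆ X)
    {C : I → Set (List ℕ) → Set (List ℕ)} (hC : ∀ i W, C i W ⊆ W)
    (hCpos : ∀ i W, [] ∉ W → ¬ FinNull W → ¬ FinNull (C i W))
    (hI : ∀ δ : I, (Set.Iio δ).Countable) :
    ∃ Y : I → Set (List ℕ), ∀ δ, TowerStep F R C δ (fun ξ _ => Y ξ) (Y δ) := by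
  classical
  let next : ∀ δ : I, (∀ ξ, ξ < δ → Set (List ℕ)) → Set (List ℕ) := fun δ Y =>
    -- The value `∅` never occurs: the induction below shows that a continuation always exists.
    if h : ∃ Z, TowerStep F R C δ Y Z then h.choose else ∅
  let Y : I → Set (List ℕ) := wellFounded_lt.fix next
  refine ⟨Y, fun δ => ?_⟩
  induction δ using WellFoundedLT.induction with
  | ind δ ih =>
    have hex : ∃ Z, TowerStep F R C δ (fun ξ _ => Y ξ) Z := by
      refine exists_towerStep h0 h1 hF hRF hR hC hCpos δ (hI δ) _ (fun ξ hξ => (ih ξ hξ).mem) ?_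
      intro ξ η hξ hη
      rcases lt_trichotomy ξ η with h | rfl | h
      · exact Or.inr ((ih η hη).almostSub ξ h)
      · exact Or.inl (AlmostSub.of_subset subset_rfl)
      · exact Or.inl ((ih ξ hξ).almostSub η h)
    have hYδ : Y δ = next δ (fun ξ _ => Y ξ) := wellFounded_lt.fix_eq next δ
    rw [hYδ]
    simp only [next, dif_pos hex]
    exact hex.choose_spec

/-- Each such `δ` has a parent, `F` or an earlier index, whose section is cut down by `C δ`.
Descending along parents reaches `F` in finitely many steps, and by almost disjointness each depth
carries at most one `δ`. -/
theorem countable_setOf_almostSub_consSection {I : Type} [LinearOrder I] [WellFoundedLT I]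
    {C : I → Set (List ℕ) → Set (List ℕ)} (hC : ∀ i W, C i W ⊆ W)
    (hCd : ∀ i j W, i ≠ j → FinNull (C i W ∩ C j W))
    {Y : I → Set (List ℕ)} (hY : ∀ δ, TowerStep F R C δ (fun ξ _ => Y ξ) (Y δ))
    (n : ℕ) {W : Set (List ℕ)} (hW : ¬ FinNull W) :
    {δ | AlmostSub W (consSection (Y δ) n)}.Countable := by
  -- `P k δ`: `δ` is reached from `F` through `k` intermediate ancestors, all of whose sections
  -- almost contain `W`.
  let P : ℕ → I → Prop := fun k => k.rec (fun δ => consSection (Y δ) n ⊆ C δ (consSection F n))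
    (fun _ p δ => ∃ ξ, p ξ ∧ AlmostSub W (consSection (Y ξ) n) ∧
      consSection (Y δ) n ⊆ C δ (consSection (Y ξ) n))
  -- Two different children of the same `V` would put `W` almost inside `C δ V ∩ C η V`, which is
  -- negligible.
  have key : ∀ δ η V, AlmostSub W (consSection (Y δ) n) → AlmostSub W (consSection (Y η) n) →
      consSection (Y δ) n ⊆ C δ V → consSection (Y η) n ⊆ C η V → δ = η := by
    intro δ η V h h' hδ hη
    by_contra hne
    refine hW ((FinNull.union (FinNull.union h h') (hCd δ η V hne)).mono fun s hs => ?_)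
    by_cases h1 : s ∈ consSection (Y δ) n
    · by_cases h2 : s ∈ consSection (Y η) n
      · exact Or.inr ⟨hδ h1, hη h2⟩
      · exact Or.inl (Or.inr ⟨hs, h2⟩)
    · exact Or.inl (Or.inl ⟨hs, h1⟩)
  have hex : ∀ δ, AlmostSub W (consSection (Y δ) n) → ∃ k, P k δ := by
    intro δ
    induction δ using WellFoundedLT.induction with
    | ind δ ih =>
      intro hδ
      rcases (hY δ).section_subset n with h | h | ⟨ξ, hξ, h⟩
      · rw [h] at hδ
        exact absurd (hδ.finNull FinNull.empty) hW
      · exact ⟨0, h⟩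
      · have hξW : AlmostSub W (consSection (Y ξ) n) :=
          hδ.trans (AlmostSub.of_subset (h.trans (hC _ _)))
        obtain ⟨k, hk⟩ := ih ξ hξ hξW
        exact ⟨k + 1, ξ, hk, hξW, h⟩
  have huniq : ∀ k δ η, AlmostSub W (consSection (Y δ) n) → AlmostSub W (consSection (Y η) n) →
      P k δ → P k η → δ = η := by
    intro k
    induction k with
    | zero => exact fun δ η hδ hη h h' => key δ η _ hδ hη h h'
    | succ k ih =>
      rintro δ η hδ hη ⟨ξ, hξ, hξW, h⟩ ⟨ζ, hζ, hζW, h'⟩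
      obtain rfl := ih ξ ζ hξW hζW hξ hζ
      exact key δ η _ hδ hη h h'
  refine (Set.countable_iUnion fun k => Set.Subsingleton.countable (s :=
    {δ | AlmostSub W (consSection (Y δ) n) ∧ P k δ}) fun δ hδ η hη =>
      huniq k δ η hδ.1 hη.1 hδ.2 hη.2).mono fun δ hδ => ?_
  obtain ⟨k, hk⟩ := hex δ hδ
  exact Set.mem_iUnion.2 ⟨k, hδ, hk⟩

/-- The tower number of every dense family of positive sets of sequences, almost all of which are
of length at least `2`, is `ℵ₁`. -/
theorem towerNumber_eq_aleph_one (h0 : [] ∉ F) (h1 : {n | [n] ∈ F}.Finite) (hF : ¬ FinNull F)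
    (hRF : ∀ X ∈ R, X ⊆ F ∧ ¬ FinNull X) (hR : ∀ X ⊆ F, ¬ FinNull X → ∃ Y ∈ R, Y ⊆ X) :
    towerNumber R AlmostSub = Cardinal.aleph 1 := by
  let I : Type := (Cardinal.aleph 1).ord.ToType
  have hcard : Cardinal.mk I = Cardinal.aleph 1 := Cardinal.mk_ord_toType _
  have hIio : ∀ δ : I, (Set.Iio δ).Countable := fun δ =>
    by
    have h := Cardinal.mk_Iio_lt δ (by rw [hcard]; exact (Ordinal.type_toType _).symm)
    rw [hcard] at h
    exact countable_iff_mk_lt_aleph_one.2 h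
  obtain ⟨C, hC, hCpos, hCd⟩ := exists_almostDisjoint_finNull hcard.le
  obtain ⟨Y, hY⟩ := exists_towerStep_sequence h0 h1 hF hRF hR hC hCpos hIio
  have htower : IsTower R AlmostSub (Set.range Y) := by
    refine ⟨?_, ?_, ?_⟩
    · rintro _ ⟨δ, rfl⟩
      exact (hY δ).mem
    · rintro _ ⟨δ, rfl⟩ _ ⟨η, rfl⟩
      rcases lt_trichotomy δ η with h | rfl | h
      · exact Or.inr ((hY η).almostSub δ h)
      · exact Or.inl (AlmostSub.of_subset subset_rfl)
      · exact Or.inl ((hY δ).almostSub η h)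
    · rintro ⟨Z, hZ, hZY⟩
      have hinf := infinite_setOf_consSection (fun h => h0 ((hRF Z hZ).1 h)) (hRF Z hZ).2
      -- `Z` has infinitely many positive sections, and almost containment fails at only finitely
      -- many of them.
      have hn : ∀ δ, ∃ n, ¬ FinNull (consSection Z n) ∧
          AlmostSub (consSection Z n) (consSection (Y δ) n) := by
        intro δ
        obtain ⟨n, hn, hn'⟩ :=
          (hinf.sdiff (hZY (Y δ) ⟨δ, rfl⟩).finite_setOf_consSection).nonempty
        exact ⟨n, hn, not_not.1 hn'⟩
      have hcount : (Set.univ : Set I).Countable := by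
        refine (Set.countable_iUnion fun n : {n // ¬ FinNull (consSection Z n)} =>
          countable_setOf_almostSub_consSection hC hCd hY n.1 n.2).mono fun δ _ => ?_
        obtain ⟨n, hn, hn'⟩ := hn δ
        exact Set.mem_iUnion.2 ⟨⟨n, hn⟩, hn'⟩
      rw [countable_iff_mk_lt_aleph_one, Cardinal.mk_univ, hcard] at hcount
      exact lt_irrefl _ hcount
  have hmem : Cardinal.mk (Set.range Y) ∈
      {κ | ∃ 𝓕 : Set (Set (List ℕ)), IsTower R AlmostSub 𝓕 ∧ Cardinal.mk 𝓕 = κ} :=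
    ⟨_, htower, rfl⟩
  refine le_antisymm ((csInf_le' hmem).trans (Cardinal.mk_range_le.trans hcard.le)) ?_
  refine le_csInf ⟨_, hmem⟩ ?_
  rintro _ ⟨T, hT, rfl⟩
  exact hT.aleph_one_le h0 h1 hF hRF hR

end Towers

/-! ### The order `≺` -/

/-- The order `≺` is pulled back from a lexicographic order. -/
def precKey (s : List ℕ) : ℕ ×ₗ List ℕ := toLex (s.getLastD 0, s)

theorem precKey_injective : Function.Injective precKey := fun _ _ h =>
  congrArg (fun x => (ofLex x).2) h

/-- The empty sequence needs no separate clause: its default last entry is `0` and it is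
lexicographically least. -/
theorem prec_iff {s t : List ℕ} : Prec s t ↔ precKey s < precKey t := by
  rw [Prod.Lex.lt_iff]
  change _ ↔ s.getLastD 0 < t.getLastD 0 ∨ s.getLastD 0 = t.getLastD 0 ∧ s < t
  constructor
  · rintro ⟨ht, rfl | h | h⟩
    · rcases Nat.eq_zero_or_pos (t.getLastD 0) with h0 | h0
      · refine Or.inr ⟨h0.symm, ?_⟩
        cases t with
        | nil => exact absurd rfl ht
        | cons a t => exact List.Lex.nil
      · exact Or.inl h0
    · exact Or.inl h
    · exact Or.inr h
  · intro h
    refine ⟨?_, Or.inr h⟩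
    rintro rfl
    rcases h with h | ⟨-, h⟩
    · exact Nat.not_lt_zero _ h
    · exact List.not_lt_nil s h

theorem Prec.trans {s t u : List ℕ} (h : Prec s t) (h' : Prec t u) : Prec s u :=
  prec_iff.2 ((prec_iff.1 h).trans (prec_iff.1 h'))

theorem Prec.irrefl (s : List ℕ) : ¬ Prec s s := fun h => lt_irrefl _ (prec_iff.1 h)

theorem Prec.asymm {s t : List ℕ} (h : Prec s t) : ¬ Prec t s := fun h' =>
  Prec.irrefl s (h.trans h')

theorem Prec.getLastD_le {s t : List ℕ} (h : Prec s t) : s.getLastD 0 ≤ t.getLastD 0 := by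
  obtain ⟨-, rfl | h | h⟩ := h
  exacts [Nat.zero_le _, h.le, h.1.le]

theorem Prec.of_getLastD_lt {s t : List ℕ} (h : s.getLastD 0 < t.getLastD 0) : Prec s t := by
  refine ⟨?_, Or.inr (Or.inl h)⟩
  rintro rfl
  exact Nat.not_lt_zero _ h

theorem prec_concat {s : List ℕ} {k : ℕ} (h : ∀ x ∈ s, x ≤ k) : Prec s (s ++ [k]) := by
  refine ⟨by simp, ?_⟩
  rcases s.eq_nil_or_concat with rfl | ⟨u, a, rfl⟩
  · exact Or.inl rfl
  · rcases (h a (by simp)).lt_or_eq with h1 | rfl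
    · exact Or.inr (Or.inl (by simpa using h1))
    · refine Or.inr (Or.inr ⟨by simp, ?_⟩)
      have := List.Lex.append_left (· < ·) (List.Lex.nil (r := (· < ·)) (a := a) (l := []))
        (u ++ [a])
      simpa using this

theorem properInit_concat (s : List ℕ) (k : ℕ) : ProperInit s (s ++ [k]) :=
  ⟨List.prefix_append _ _, by simp⟩

/-! ### Fronts -/

/-- A front of non-decreasing sequences: the tree of initial segments of members of `F` is
well-founded with set of maximal nodes `F`, and all nodes outside `F` branch as much as possible. -/
structure IsFront (F : Set (List ℕ)) : Prop where
  nil_mem : [] ∈ initSegs F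
  sorted : ∀ t ∈ F, t.Pairwise (· ≤ ·)
  antichain : ∀ s ∈ F, ∀ t ∈ F, s <+: t → s = t
  extend : ∀ t ∈ initSegs F, t ∉ F → ∀ m, (∀ x ∈ t, x ≤ m) → t ++ [m] ∈ initSegs F
  induct : ∀ P : List ℕ → Prop,
    (∀ w ∈ initSegs F, (w ∉ F → ∀ v, w ++ [v] ∈ initSegs F → P (w ++ [v])) → P w) →
      ∀ w ∈ initSegs F, P w

/-- The section of a set of sequences at an initial segment `t`. -/
def appendSection (X : Set (List ℕ)) (t : List ℕ) : Set (List ℕ) := {u | t ++ u ∈ X}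

theorem consSection_appendSection (X : Set (List ℕ)) (t : List ℕ) (v : ℕ) :
    consSection (appendSection X t) v = appendSection X (t ++ [v]) := by
  ext u
  simp [consSection, appendSection]

theorem not_finNull_of_nil_mem {X : Set (List ℕ)} (h : [] ∈ X) : ¬ FinNull X := fun hX =>
  (finNull_iff.1 hX).1 h

theorem not_finNull_of_infinite {X : Set (List ℕ)}
    (h : {n | ¬ FinNull (consSection X n)}.Infinite) : ¬ FinNull X := fun hX =>
  h (finNull_iff.1 hX).2

theorem le_getLastD_of_pairwise {s : List ℕ} (hs : s.Pairwise (· ≤ ·)) {x : ℕ} (hx : x ∈ s) :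
    x ≤ s.getLastD 0 := by
  rcases s.eq_nil_or_concat with rfl | ⟨u, a, rfl⟩
  · simp at hx
  · simp only [List.concat_eq_append] at hs hx ⊢
    rw [List.pairwise_append] at hs
    rcases List.mem_append.1 hx with hx | hx
    · simpa using hs.2.2 x hx a (by simp)
    · simpa using (List.mem_singleton.1 hx).le

section Front

variable {F : Set (List ℕ)}

theorem IsFront.not_finNull_appendSection (hF : IsFront F) :
    ∀ w ∈ initSegs F, ¬ FinNull (appendSection F w) := by
  refine hF.induct _ fun w hw ih => ?_
  by_cases hwF : w ∈ F
  · exact not_finNull_of_nil_mem (by simpa [appendSection] using hwF)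
  · refine not_finNull_of_infinite ((Set.Ici_infinite (w.foldr max 0)).mono fun n hn => ?_)
    rw [Set.mem_ofPred_eq, consSection_appendSection]
    refine ih hwF n (hF.extend w hw hwF n fun x hx => le_trans ?_ hn)
    clear hw ih hwF hn
    induction w with
    | nil => simp at hx
    | cons a w ih =>
      rcases List.mem_cons.1 hx with rfl | hx
      · exact le_max_left _ _
      · exact (ih hx).trans (le_max_right _ _)

theorem IsFront.not_finNull (hF : IsFront F) : ¬ FinNull F := hF.not_finNull_appendSection [] hF.nil_mem

/-- Induction runs over the values `w = f s`, since the front is well-founded there. Preservation of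
`≺` makes the entries added by the successors of `s` distinct, giving infinitely many positive
sections. -/
theorem IsETree.not_finNull_appendSection (hF : IsFront F) {D : Set (List ℕ)} {f : List ℕ → List ℕ}
    (hf : IsETree F D f) : ∀ w ∈ initSegs F, ∀ s ∈ D, f s = w →
      ¬ FinNull (appendSection (f '' {s | s ∈ D ∧ f s ∈ F}) w) := by
  refine hF.induct _ fun w hw ih s hs hsw => ?_
  subst hsw
  by_cases hsF : f s ∈ F
  · refine not_finNull_of_nil_mem ?_
    simpa [appendSection] using ⟨s, ⟨hs, hsF⟩, rfl⟩
  · let N := s.foldr max 0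
    have hN : ∀ m, ∀ x ∈ s, x ≤ N + m := by
      intro m x hx
      refine le_trans ?_ (Nat.le_add_right N m)
      clear hsF ih hw hs
      induction s with
      | nil => simp at hx
      | cons a s ih =>
        rcases List.mem_cons.1 hx with rfl | hx
        · exact le_max_left _ _
        · exact (ih hx).trans (le_max_right _ _)
    have hD : ∀ m, s ++ [N + m] ∈ D := fun m => (hf.concat_mem s _).2 ⟨hs, hsF, hN m⟩
    have hv : ∀ m, ∃ v, f (s ++ [N + m]) = f s ++ [v] := by
      intro m
      obtain ⟨⟨u, hu⟩, -⟩ := hf.init s hs _ (hD m) (properInit_concat s _)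
      have hlen : u.length = 1 := by
        have h1 := congrArg List.length hu
        rw [List.length_append, hf.length_eq s hs, hf.length_eq _ (hD m)] at h1
        simpa using h1
      obtain ⟨v, rfl⟩ := List.length_eq_one_iff.1 hlen
      exact ⟨v, hu.symm⟩
    choose v hv using hv
    have hmono : ∀ m n, m < n → v m ≠ v n := by
      intro m n hmn heq
      have h1 : Prec (s ++ [N + m]) (s ++ [N + n]) := Prec.of_getLastD_lt (by simpa using hmn)
      have h2 := hf.prec _ (hD m) _ (hD n) h1
      rw [hv, hv, heq] at h2
      exact Prec.irrefl _ h2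
    have hinj : Function.Injective v := by
      intro m n h
      by_contra hne
      rcases lt_or_gt_of_ne hne with h' | h'
      exacts [hmono _ _ h' h, hmono _ _ h' h.symm]
    refine not_finNull_of_infinite ((Set.infinite_range_of_injective hinj).mono ?_)
    rintro _ ⟨m, rfl⟩
    rw [Set.mem_ofPred_eq, consSection_appendSection]
    refine ih hsF _ ?_ _ (hD m) (hv m)
    rw [← hv]
    exact hf.maps _ (hD m)

theorem IsFront.pos_of_mem_ellentuckOn (hF : IsFront F) {X : Set (List ℕ)} (hX : X ∈ EllentuckOn F) :
    X ⊆ F ∧ ¬ FinNull X := by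
  obtain ⟨D, f, hf, rfl⟩ := hX
  refine ⟨?_, ?_⟩
  · rintro _ ⟨s, hs, rfl⟩
    exact hs.2
  · exact IsETree.not_finNull_appendSection hF hf [] hF.nil_mem [] hf.nil_mem
      (List.length_eq_zero_iff.1 (hf.length_eq _ hf.nil_mem))

end Front

/-! ### Building trees inside positive sets -/

/-- A set `A` of sequences of pairs, viewed as the partial map of sequences that sends the
first coordinates to the second ones, is an initial part of an `𝓔`-tree with values in `G`. -/
structure IsPartialTree (F G : Set (List ℕ)) (A : Set (List (ℕ × ℕ))) : Prop where
  nil_mem : [] ∈ A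
  of_concat : ∀ p m v, p ++ [(m, v)] ∈ A →
    p ∈ A ∧ p.map Prod.snd ∉ F ∧ ∀ x ∈ p.map Prod.fst, x ≤ m
  maps : ∀ p ∈ A, p.map Prod.snd ∈ G
  inj : ∀ p ∈ A, ∀ q ∈ A, p.map Prod.fst = q.map Prod.fst → p = q
  -- Stronger than preserving `≺`: strictly larger last entries settle the order at once.
  prec : ∀ p ∈ A, ∀ q ∈ A, Prec (p.map Prod.fst) (q.map Prod.fst) →
    (p.map Prod.snd).getLastD 0 < (q.map Prod.snd).getLastD 0
  -- Nodes are filled in the order `≺`.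
  closed : ∀ p ∈ A, p.map Prod.snd ∉ F → ∀ m, (∀ x ∈ p.map Prod.fst, x ≤ m) →
    ∀ q ∈ A, Prec (p.map Prod.fst ++ [m]) (q.map Prod.fst) → ∃ v, p ++ [(m, v)] ∈ A

section PartialTree

variable {F G : Set (List ℕ)} {A : Set (List (ℕ × ℕ))}

theorem IsPartialTree.singleton_nil (hG : [] ∈ G) : IsPartialTree F G {[]} where
  nil_mem := rfl
  of_concat := by
    intro p m v h
    simp at h
  maps := by
    rintro _ rfl
    exact hG
  inj := by
    rintro _ rfl _ rfl -
    rfl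
  prec := by
    rintro _ rfl _ rfl h
    exact absurd h (Prec.irrefl _)
  closed := by
    rintro _ - - m - _ rfl h
    exact absurd rfl h.1

theorem IsPartialTree.sUnion {c : Set (Set (List (ℕ × ℕ)))}
    (hc : ∀ A ∈ c, IsPartialTree F G A) (hchain : IsChain (· ⊆ ·) c) (hne : c.Nonempty) :
    IsPartialTree F G (⋃₀ c) := by
  have two : ∀ p ∈ ⋃₀ c, ∀ q ∈ ⋃₀ c, ∃ A ∈ c, p ∈ A ∧ q ∈ A := by
    rintro p ⟨A, hA, hp⟩ q ⟨A', hA', hq⟩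
    rcases hchain.total hA hA' with h | h
    exacts [⟨A', hA', h hp, hq⟩, ⟨A, hA, hp, h hq⟩]
  constructor
  · obtain ⟨A, hA⟩ := hne
    exact ⟨A, hA, (hc A hA).nil_mem⟩
  · rintro p m v ⟨A, hA, h⟩
    exact ⟨⟨A, hA, ((hc A hA).of_concat p m v h).1⟩, ((hc A hA).of_concat p m v h).2⟩
  · rintro p ⟨A, hA, h⟩
    exact (hc A hA).maps p h
  · intro p hp q hq
    obtain ⟨A, hA, hp, hq⟩ := two p hp q hq
    exact (hc A hA).inj p hp q hq
  · intro p hp q hq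
    obtain ⟨A, hA, hp, hq⟩ := two p hp q hq
    exact (hc A hA).prec p hp q hq
  · intro p hp hpF m hm q hq h
    obtain ⟨A, hA, hp, hq⟩ := two p hp q hq
    obtain ⟨v, hv⟩ := (hc A hA).closed p hp hpF m hm q hq h
    exact ⟨v, A, hA, hv⟩

theorem IsPartialTree.of_append (hA : IsPartialTree F G A) {p q : List (ℕ × ℕ)}
    (h : p ++ q ∈ A) : p ∈ A := by
  induction q using List.reverseRecOn with
  | nil => simpa using h
  | append_singleton q a ih =>
    rw [← List.append_assoc] at h
    exact ih (hA.of_concat _ _ _ h).1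

theorem IsPartialTree.le_getLastD (hA : IsPartialTree F G A) {p : List (ℕ × ℕ)} (hp : p ∈ A)
    {x : ℕ} (hx : x ∈ p.map Prod.fst) : x ≤ (p.map Prod.fst).getLastD 0 := by
  induction p using List.reverseRecOn with
  | nil => simp at hx
  | append_singleton p a ih =>
    obtain ⟨-, -, h⟩ := hA.of_concat p a.1 a.2 hp
    rw [List.map_append, List.mem_append] at hx
    rcases hx with hx | hx
    · simpa using h x hx
    · simpa using (List.mem_singleton.1 hx).le

theorem IsPartialTree.exists_of_map_eq (hA : IsPartialTree F G A) {p q : List (ℕ × ℕ)} {m : ℕ}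
    (hp : p ∈ A) (hq : q ∈ A) (h : q.map Prod.fst = p.map Prod.fst ++ [m]) :
    ∃ v, q = p ++ [(m, v)] := by
  rcases q.eq_nil_or_concat with rfl | ⟨q, a, rfl⟩
  · simp at h
  · simp only [List.concat_eq_append] at hq h ⊢
    rw [List.map_append, List.map_singleton] at h
    obtain ⟨h1, h2⟩ := List.append_inj' h rfl
    obtain rfl := hA.inj q (hA.of_append hq) p hp h1
    obtain rfl : a.1 = m := by simpa using h2
    exact ⟨a.2, rfl⟩

/-- By induction on the front: `inj` allows at most one child per first coordinate, hence at most `K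
+ 1` relevant children. -/
theorem IsPartialTree.finite_above (hF : IsFront F) (hG : G ⊆ initSegs F)
    (hA : IsPartialTree F G A) (K : ℕ) : ∀ w ∈ initSegs F, ∀ p ∈ A, p.map Prod.snd = w →
      {q | q ∈ A ∧ p <+: q ∧ ∀ x ∈ q.map Prod.fst, x ≤ K}.Finite := by
  refine hF.induct _ fun w _ ih p hp hpw => ?_
  subst hpw
  have hfin : ∀ k, {q | q ∈ A ∧ (∃ v, p ++ [(k, v)] <+: q) ∧
      ∀ x ∈ q.map Prod.fst, x ≤ K}.Finite := by
    intro k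
    by_cases hk : ∃ v, p ++ [(k, v)] ∈ A
    · obtain ⟨v, hv⟩ := hk
      have hmap : (p ++ [(k, v)]).map Prod.snd = p.map Prod.snd ++ [v] := by simp
      refine (ih (hA.of_concat _ _ _ hv).2.1 v (hmap ▸ hG (hA.maps _ hv)) _ hv hmap).subset ?_
      rintro q ⟨hq, ⟨v', r, rfl⟩, hqK⟩
      have := hA.inj _ (hA.of_append hq) _ hv (by simp)
      exact ⟨hq, ⟨r, by rw [this]⟩, hqK⟩
    · refine Set.finite_empty.subset ?_
      rintro q ⟨hq, ⟨v', r, rfl⟩, -⟩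
      exact hk ⟨v', hA.of_append hq⟩
  refine ((Set.finite_singleton p).union
    ((Set.finite_Iic K).biUnion fun k _ => hfin k)).subset ?_
  rintro q ⟨hq, ⟨r, rfl⟩, hqK⟩
  cases r with
  | nil => exact Or.inl (by simp)
  | cons a r =>
    refine Or.inr (Set.mem_biUnion (x := a.1) (hqK _ (by simp)) ⟨hq, ⟨a.2, r, by simp⟩, hqK⟩)

/-- The `≺`-least missing node `s` is added. All of `A` precedes it, so `A` is finite, and infinite
branching of `G` offers a value beyond all last entries used so far. -/
theorem IsPartialTree.exists_insert (hF : IsFront F) (hG : G ⊆ initSegs F)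
    (hGinf : ∀ t ∈ G, t ∉ F → {v | t ++ [v] ∈ G}.Infinite) (hA : IsPartialTree F G A)
    (hpend : ∃ p ∈ A, p.map Prod.snd ∉ F ∧ ∃ m, (∀ x ∈ p.map Prod.fst, x ≤ m) ∧
      ∀ v, p ++ [(m, v)] ∉ A) :
    ∃ r ∉ A, IsPartialTree F G (insert r A) := by
  let Pend : ℕ → Set (List (ℕ × ℕ)) := fun m => {p | p ∈ A ∧ p.map Prod.snd ∉ F ∧
    (∀ x ∈ p.map Prod.fst, x ≤ m) ∧ ∀ v, p ++ [(m, v)] ∉ A}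
  have hfin : ∀ K, {q | q ∈ A ∧ ∀ x ∈ q.map Prod.fst, x ≤ K}.Finite := fun K =>
    (hA.finite_above hF hG K [] hF.nil_mem [] hA.nil_mem rfl).subset fun q hq =>
      ⟨hq.1, List.nil_prefix, hq.2⟩
  classical
  have hex : ∃ m, (Pend m).Nonempty := by
    obtain ⟨p, hp, hpF, m, hm, hv⟩ := hpend
    exact ⟨m, p, hp, hpF, hm, hv⟩
  let m := Nat.find hex
  -- Least last entry `m` first, then lexicographically least: this is the `≺`-least missing node.
  obtain ⟨p, ⟨hp, hpF, hpm, hpv⟩, hmin⟩ := Set.exists_min_image (Pend m)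
    (fun p => p.map Prod.fst ++ [m]) ((hfin m).subset fun q hq => ⟨hq.1, hq.2.2.1⟩)
    (Nat.find_spec hex)
  set s := p.map Prod.fst ++ [m] with hs
  have hleast : ∀ q k, q ∈ Pend k → ¬ Prec (q.map Prod.fst ++ [k]) s := by
    intro q k hq h
    have hmk : m ≤ k := Nat.find_min' hex ⟨q, hq⟩
    have hkm : k ≤ m := by simpa [hs] using h.getLastD_le
    obtain rfl := le_antisymm hmk hkm
    rw [prec_iff, Prod.Lex.lt_iff] at h
    rcases h with h | h
    · simp [precKey, hs] at h
    · exact not_lt.2 (hmin q hq) h.2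
  have hlt : ∀ q ∈ A, Prec (q.map Prod.fst) s := by
    intro q hq
    rcases lt_trichotomy (precKey (q.map Prod.fst)) (precKey s) with h | h | h
    · exact prec_iff.2 h
    · obtain ⟨v, rfl⟩ := hA.exists_of_map_eq hp hq (precKey_injective h)
      exact absurd hq (hpv v)
    · obtain ⟨v, hv⟩ := hA.closed p hp hpF m hpm q hq (prec_iff.2 h)
      exact absurd hv (hpv v)
  have hAfin : A.Finite := by
    refine (hfin m).subset fun q hq => ⟨hq, fun x hx => ?_⟩
    simpa [hs] using (hA.le_getLastD hq hx).trans (hlt q hq).getLastD_le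
  obtain ⟨N, hN⟩ := (hAfin.image fun q => (q.map Prod.snd).getLastD 0).bddAbove
  obtain ⟨v, hvG, hv⟩ := (hGinf _ (hA.maps p hp) hpF).exists_gt N
  have hvN : ∀ q ∈ A, (q.map Prod.snd).getLastD 0 < v := fun q hq =>
    (hN ⟨q, hq, rfl⟩).trans_lt hv
  have hr1 : (p ++ [(m, v)]).map Prod.fst = s := by simp [hs]
  have hr2 : ((p ++ [(m, v)]).map Prod.snd).getLastD 0 = v := by simp
  -- Nothing lies beyond a successor of `s`, so `closed` is vacuous at the new node.
  have hss : ∀ k, (∀ x ∈ s, x ≤ k) → ∀ q ∈ insert (p ++ [(m, v)]) A,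
      ¬ Prec (s ++ [k]) (q.map Prod.fst) := by
    intro k hk q hq h
    have h' := (prec_concat hk).trans h
    rcases hq with rfl | hq
    · rw [hr1] at h'
      exact Prec.irrefl _ h'
    · exact h'.asymm (hlt q hq)
  refine ⟨p ++ [(m, v)], hpv v, ?_⟩
  constructor
  · exact Or.inr hA.nil_mem
  · rintro q k u (h | h)
    · obtain ⟨rfl, h2⟩ := List.append_inj' h rfl
      obtain ⟨rfl, -⟩ : k = m ∧ u = v := by simpa using h2
      exact ⟨Or.inr hp, hpF, hpm⟩
    · obtain ⟨h1, h2⟩ := hA.of_concat q k u h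
      exact ⟨Or.inr h1, h2⟩
  · rintro q (rfl | hq)
    · simpa using hvG
    · exact hA.maps q hq
  · rintro q (rfl | hq) q' (rfl | hq') h
    · rfl
    · rw [hr1] at h
      exact absurd (h ▸ hlt q' hq') (Prec.irrefl _)
    · rw [hr1] at h
      exact absurd (h ▸ hlt q hq) (Prec.irrefl _)
    · exact hA.inj q hq q' hq' h
  · rintro q (rfl | hq) q' (rfl | hq') h
    · exact absurd h (Prec.irrefl _)
    · rw [hr1] at h
      exact absurd h (hlt q' hq').asymm
    · rw [hr2]
      exact hvN q hq
    · exact hA.prec q hq q' hq' h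
  · rintro q (rfl | hq) hqF k hk t ht h
    · rw [hr1] at h hk
      exact absurd h (hss k hk t ht)
    · rcases ht with rfl | ht
      · by_contra hne
        push Not at hne
        rw [hr1] at h
        exact hleast q k ⟨hq, hqF, hk, fun u hu => hne u (Or.inr hu)⟩ h
      · obtain ⟨u, hu⟩ := hA.closed q hq hqF k hk t ht h
        exact ⟨u, Or.inr hu⟩

/-- A subtree `G` of the tree of a front which branches infinitely at all nonmaximal nodes
contains the range of an `𝓔`-tree. -/
theorem IsFront.exists_isETree (hF : IsFront F) (hG : G ⊆ initSegs F) (hG0 : [] ∈ G)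
    (hGinf : ∀ t ∈ G, t ∉ F → {v | t ++ [v] ∈ G}.Infinite) :
    ∃ D f, IsETree F D f ∧ ∀ s ∈ D, f s ∈ G := by
  classical
  obtain ⟨A, -, hmax⟩ := zorn_subset_nonempty {A | IsPartialTree F G A}
    (fun c hc hchain hne => ⟨⋃₀ c, IsPartialTree.sUnion hc hchain hne,
      fun A hA => Set.subset_sUnion_of_mem hA⟩) {[]} (IsPartialTree.singleton_nil hG0)
  have hA : IsPartialTree F G A := hmax.prop
  -- By maximality no node is missing.
  have htotal : ∀ p ∈ A, p.map Prod.snd ∉ F → ∀ m, (∀ x ∈ p.map Prod.fst, x ≤ m) →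
      ∃ v, p ++ [(m, v)] ∈ A := by
    intro p hp hpF m hm
    by_contra hne
    push Not at hne
    obtain ⟨r, hr, hr'⟩ := hA.exists_insert hF hG hGinf ⟨p, hp, hpF, m, hm, hne⟩
    exact hr (hmax.le_of_ge hr' (Set.subset_insert _ _) (Set.mem_insert _ _))
  let f : List ℕ → List ℕ := fun s =>
    if h : ∃ p ∈ A, p.map Prod.fst = s then h.choose.map Prod.snd else []
  have hf : ∀ p ∈ A, f (p.map Prod.fst) = p.map Prod.snd := by
    intro p hp
    have h : ∃ q ∈ A, q.map Prod.fst = p.map Prod.fst := ⟨p, hp, rfl⟩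
    simp only [f, dif_pos h]
    rw [hA.inj _ h.choose_spec.1 p hp h.choose_spec.2]
  refine ⟨(List.map Prod.fst) '' A, f, ⟨⟨[], hA.nil_mem, rfl⟩, ?_, ?_, ?_, ?_, ?_⟩, ?_⟩
  · intro s m
    constructor
    · rintro ⟨q, hq, h⟩
      rcases q.eq_nil_or_concat with rfl | ⟨q, a, rfl⟩
      · simp at h
      · simp only [List.concat_eq_append] at hq h
        rw [List.map_append, List.map_singleton] at h
        obtain ⟨rfl, h2⟩ := List.append_inj' h rfl
        obtain rfl : a.1 = m := by simpa using h2
        obtain ⟨h1, h2, h3⟩ := hA.of_concat q a.1 a.2 hq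
        exact ⟨⟨q, h1, rfl⟩, by rwa [hf q h1], h3⟩
    · rintro ⟨⟨p, hp, rfl⟩, hpF, hm⟩
      rw [hf p hp] at hpF
      obtain ⟨v, hv⟩ := htotal p hp hpF m hm
      exact ⟨_, hv, by simp⟩
  · rintro _ ⟨p, hp, rfl⟩
    rw [hf p hp]
    exact hG (hA.maps p hp)
  · rintro _ ⟨p, hp, rfl⟩
    rw [hf p hp, List.length_map, List.length_map]
  · rintro _ ⟨p, hp, rfl⟩ _ ⟨q, hq, rfl⟩ h
    rw [hf p hp, hf q hq]
    exact Prec.of_getLastD_lt (hA.prec p hp q hq h)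
  · rintro _ ⟨p, hp, rfl⟩ _ ⟨q, hq, rfl⟩ ⟨h, hne⟩
    rw [hf p hp, hf q hq]
    have hpq : p <+: q := by
      have hl : p.length ≤ q.length := by simpa using h.length_le
      have htake : q.take p.length ∈ A := by
        refine hA.of_append (q := q.drop p.length) ?_
        rwa [List.take_append_drop]
      have : p = q.take p.length := by
        refine hA.inj _ hp _ htake ?_
        rw [List.map_take]
        simpa using List.prefix_iff_eq_take.1 h
      rw [this]
      exact List.take_prefix _ _
    refine ⟨hpq.map _, fun heq => hne ?_⟩
    have hl : p.length = q.length := by simpa using congrArg List.length heq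
    rw [hpq.eq_of_length hl]
  · rintro _ ⟨p, hp, rfl⟩
    rw [hf p hp]
    exact hA.maps p hp

/-- The members of the Ellentuck space of a front are dense in the positive sets. -/
theorem IsFront.exists_ellentuckOn_subset (hF : IsFront F) {X : Set (List ℕ)} (hX : X ⊆ F)
    (hXpos : ¬ FinNull X) : ∃ Y ∈ EllentuckOn F, Y ⊆ X := by
  have hsub : {t | ¬ FinNull (appendSection X t)} ⊆ initSegs F := by
    intro t ht
    by_contra hne
    refine ht (FinNull.empty.mono fun u hu => ?_)
    exact hne ⟨_, hX hu, List.prefix_append _ _⟩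
  -- The nodes with positive section form an infinitely branching tree; a maximal node in it belongs
  -- to `X` because `F` is an antichain.
  obtain ⟨D, f, hf, hfG⟩ := hF.exists_isETree (G := {t | ¬ FinNull (appendSection X t)}) hsub
    hXpos (by
      intro t ht htF
      have h0 : [] ∉ appendSection X t := fun h => htF (hX (by simpa [appendSection] using h))
      refine (infinite_setOf_consSection h0 ht).mono fun v hv => ?_
      rwa [Set.mem_ofPred_eq, consSection_appendSection] at hv)
  refine ⟨_, ⟨D, f, hf, rfl⟩, ?_⟩
  rintro _ ⟨s, ⟨hs, hsF⟩, rfl⟩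
  by_contra hne
  refine hfG s hs (FinNull.empty.mono fun u hu => ?_)
  have h1 := hF.antichain _ hsF _ (hX hu) (List.prefix_append _ _)
  rw [appendSection, Set.mem_ofPred_eq, ← h1] at hu
  exact hne hu

end PartialTree

/-! ### The front of a barrier -/

/-- The inverse of the passage from increasing to non-decreasing sequences. -/
def increasingOf (t : List ℕ) : List ℕ := t.mapIdx fun i x => x + i

theorem mapIdx_prefix {f : ℕ → ℕ → ℕ} {s t : List ℕ} (h : s <+: t) :
    s.mapIdx f <+: t.mapIdx f := by
  obtain ⟨u, rfl⟩ := h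
  rw [List.mapIdx_append]
  exact List.prefix_append _ _

theorem le_getElem_of_sorted {l : List ℕ} (hl : l.Pairwise (· < ·)) (i : ℕ) (hi : i < l.length) :
    i ≤ l[i] := by
  induction i with
  | zero => exact Nat.zero_le _
  | succ i ih =>
    exact (ih (by lia)).trans_lt (List.pairwise_iff_getElem.1 hl i (i + 1) (by lia) hi (by lia))

theorem increasingOf_sub {l : List ℕ} (hl : l.Pairwise (· < ·)) :
    increasingOf (l.mapIdx fun i x => x - i) = l := by
  refine List.ext_getElem (by simp [increasingOf]) fun i h1 h2 => ?_
  simpa [increasingOf] using Nat.sub_add_cancel (le_getElem_of_sorted hl i h2)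

theorem sub_increasingOf (t : List ℕ) :
    (increasingOf t).mapIdx (fun i x => x - i) = t := by
  refine List.ext_getElem (by simp [increasingOf]) fun i h1 h2 => ?_
  simp [increasingOf]

theorem pairwise_increasingOf {t : List ℕ} (ht : t.Pairwise (· ≤ ·)) :
    (increasingOf t).Pairwise (· < ·) := by
  rw [List.pairwise_iff_getElem] at ht ⊢
  intro i j hi hj hij
  have h := ht i j (by simpa [increasingOf] using hi) (by simpa [increasingOf] using hj) hij
  simp only [increasingOf, List.getElem_mapIdx]
  lia

theorem pairwise_sub {l : List ℕ} (hl : l.Pairwise (· < ·)) :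
    (l.mapIdx fun i x => x - i).Pairwise (· ≤ ·) := by
  have key : ∀ i d, ∀ h : i + d < l.length, l[i] + d ≤ l[i + d] := by
    intro i d
    induction d with
    | zero => simp
    | succ d ih =>
      intro h
      have h1 := ih (by lia)
      have h2 := List.pairwise_iff_getElem.1 hl (i + d) (i + (d + 1)) (by lia) h (by lia)
      lia
  rw [List.pairwise_iff_getElem]
  intro i j hi hj hij
  obtain ⟨d, rfl⟩ := Nat.exists_eq_add_of_lt hij
  simp only [List.getElem_mapIdx]
  have := key i (d + 1) (by simpa [← Nat.add_assoc] using hj)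
  simp only [← Nat.add_assoc] at this
  lia

theorem pairwise_sort_lt (b : Finset ℕ) : (b.sort (· ≤ ·)).Pairwise (· < ·) :=
  (Finset.sortedLT_sort b).pairwise

theorem increasingOf_nondecOf (b : Finset ℕ) : increasingOf (nondecOf b) = b.sort (· ≤ ·) :=
  increasingOf_sub (pairwise_sort_lt b)

theorem pairwise_nondecOf (b : Finset ℕ) : (nondecOf b).Pairwise (· ≤ ·) :=
  pairwise_sub (pairwise_sort_lt b)

theorem length_nondecOf (b : Finset ℕ) : (nondecOf b).length = b.card := by
  simp [nondecOf]

theorem subset_of_nondecOf_prefix {b c : Finset ℕ} (h : nondecOf b <+: nondecOf c) : b ⊆ c := by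
  have h1 := mapIdx_prefix (f := fun i x => x + i) h
  change increasingOf _ <+: increasingOf _ at h1
  rw [increasingOf_nondecOf, increasingOf_nondecOf] at h1
  intro x hx
  exact (Finset.mem_sort _).1 (h1.subset ((Finset.mem_sort _).2 hx))

/-- The hypotheses force equal heads: the smaller head would have to occur in the other list, whose
entries are all larger. -/
theorem prefix_or_prefix_of_sorted {l₁ l₂ : List ℕ} (h₁ : l₁.Pairwise (· < ·))
    (h₂ : l₂.Pairwise (· < ·)) (h : ∀ x ∈ l₁, ∀ y ∈ l₂, y ≤ x → y ∈ l₁)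
    (h' : ∀ x ∈ l₂, ∀ y ∈ l₁, y ≤ x → y ∈ l₂) : l₁ <+: l₂ ∨ l₂ <+: l₁ := by
  induction l₁ generalizing l₂ with
  | nil => exact Or.inl List.nil_prefix
  | cons a l₁ ih =>
    cases l₂ with
    | nil => exact Or.inr List.nil_prefix
    | cons b l₂ =>
      rw [List.pairwise_cons] at h₁ h₂
      obtain rfl : a = b := by
        rcases lt_trichotomy a b with hab | hab | hab
        · rcases List.mem_cons.1 (h' b (by simp) a (by simp) hab.le) with rfl | hm
          · rfl
          · exact absurd (h₂.1 a hm) (by lia)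
        · exact hab
        · rcases List.mem_cons.1 (h a (by simp) b (by simp) hab.le) with rfl | hm
          · rfl
          · exact absurd (h₁.1 b hm) (by lia)
      have := ih h₁.2 h₂.2
        (fun x hx y hy hyx => (List.mem_cons.1 (h x (by simp [hx]) y (by simp [hy]) hyx)).resolve_left
          (h₂.1 y hy).ne')
        (fun x hx y hy hyx => (List.mem_cons.1 (h' x (by simp [hx]) y (by simp [hy]) hyx)).resolve_left
          (h₁.1 y hy).ne')
      simpa [List.cons_prefix_cons] using this

theorem nondecOf_prefix_of_sort_prefix {b : Finset ℕ} {t : List ℕ}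
    (h : b.sort (· ≤ ·) <+: increasingOf t) : nondecOf b <+: t := by
  have := mapIdx_prefix (f := fun i x => x - i) h
  rwa [sub_increasingOf] at this

theorem prefix_nondecOf_of_prefix_sort {b : Finset ℕ} {t : List ℕ}
    (h : increasingOf t <+: b.sort (· ≤ ·)) : t <+: nondecOf b := by
  have := mapIdx_prefix (f := fun i x => x - i) h
  rwa [sub_increasingOf] at this

theorem IsBarrier.prefix_eq {B : Set (Finset ℕ)} (hB : IsBarrier B) :
    ∀ s ∈ nondecFamily B, ∀ t ∈ nondecFamily B, s <+: t → s = t := by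
  rintro _ ⟨b, hb, rfl⟩ _ ⟨c, hc, rfl⟩ h
  rw [hB.1 b hb c hc (subset_of_nondecOf_prefix h)]

theorem IsBarrier.prefix_or_prefix {B : Set (Finset ℕ)} (hB : IsBarrier B) {t : List ℕ}
    (ht : t.Pairwise (· ≤ ·)) :
    ∃ s ∈ nondecFamily B, s <+: t ∨ t <+: s := by
  have hl := pairwise_increasingOf ht
  obtain ⟨M, hM⟩ : ∃ M, ∀ x ∈ increasingOf t, x ≤ M := by
    obtain ⟨M, hM⟩ := (increasingOf t).toFinset.bddAbove
    exact ⟨M, fun x hx => hM (by simpa using hx)⟩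
  -- A tail above `t` makes the set infinite while keeping `t` as an initial segment of it.
  obtain ⟨b, hb, n, hn⟩ := hB.2 ({x | x ∈ increasingOf t} ∪ Set.Ioi M)
    ((Set.Ioi_infinite M).mono Set.subset_union_right)
  have hmem : ∀ x, x ∈ b.sort (· ≤ ·) ↔ (x ∈ increasingOf t ∨ M < x) ∧ x < n := by
    intro x
    rw [Finset.mem_sort, ← Finset.mem_coe, hn]
    rfl
  refine ⟨_, ⟨b, hb, rfl⟩, ?_⟩
  refine (prefix_or_prefix_of_sorted (pairwise_sort_lt b) hl ?_ ?_).imp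
    nondecOf_prefix_of_sort_prefix prefix_nondecOf_of_prefix_sort
  · intro x hx y hy hyx
    exact (hmem y).2 ⟨Or.inl hy, hyx.trans_lt ((hmem x).1 hx).2⟩
  · intro x hx y hy hyx
    exact ((hmem y).1 hy).1.resolve_right (not_lt.2 (hyx.trans (hM x hx)))

/-- An infinite branch would enumerate an infinite set; its initial segment in `B` would be properly
extended, along the branch, by another member of the antichain. -/
theorem IsBarrier.not_forall_mem_initSegs {B : Set (Finset ℕ)} (hB : IsBarrier B)
    (w : ℕ → List ℕ) (hw : ∀ i, w i ∈ initSegs (nondecFamily B))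
    (hlen : ∀ i, i ≤ (w i).length) (hpre : ∀ i j, i ≤ j → w i <+: w j) : False := by
  have hsorted : ∀ i, (w i).Pairwise (· ≤ ·) := by
    intro i
    obtain ⟨_, ⟨b, -, rfl⟩, h⟩ := hw i
    exact (pairwise_nondecOf b).sublist h.sublist
  have hsub : ∀ i j, i ≤ j → increasingOf (w i) <+: increasingOf (w j) := fun i j h =>
    mapIdx_prefix (hpre i j h)
  let X : Set ℕ := {x | ∃ i, x ∈ increasingOf (w i)}
  have hX : X.Infinite := by
    intro hfin
    have hle : (increasingOf (w (hfin.toFinset.card + 1))).toFinset.card ≤ hfin.toFinset.card :=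
      Finset.card_le_card fun x hx => by
        rw [Set.Finite.mem_toFinset]
        exact ⟨_, by simpa using hx⟩
    rw [List.toFinset_card_of_nodup ((pairwise_increasingOf (hsorted _)).imp ne_of_lt)] at hle
    have := hlen (hfin.toFinset.card + 1)
    simp only [increasingOf, List.length_mapIdx] at hle
    lia
  obtain ⟨b, hb, n, hn⟩ := hB.2 X hX
  have hmem : ∀ x, x ∈ b.sort (· ≤ ·) ↔ (∃ i, x ∈ increasingOf (w i)) ∧ x < n := by
    intro x
    rw [Finset.mem_sort, ← Finset.mem_coe, hn]
    rfl
  -- Chosen so that `w i` is strictly longer than `b`.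
  let i := b.card + 1
  have hi := hlen i
  have hprefix : nondecOf b <+: w i := by
    refine nondecOf_prefix_of_sort_prefix ?_
    have hinit : ∀ x ∈ increasingOf (w i), ∀ y ∈ b.sort (· ≤ ·), y ≤ x →
        y ∈ increasingOf (w i) := by
      intro x hx y hy hyx
      obtain ⟨⟨j, hj⟩, -⟩ := (hmem y).1 hy
      rcases le_total j i with hji | hij
      · exact (hsub j i hji).subset hj
      · obtain ⟨u, hu⟩ := hsub i j hij
        rw [← hu] at hj
        rcases List.mem_append.1 hj with hj | hj
        · exact hj
        · have hp := pairwise_increasingOf (hsorted j)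
          rw [← hu, List.pairwise_append] at hp
          exact absurd (hp.2.2 x hx y hj) (not_lt.2 hyx)
    rcases prefix_or_prefix_of_sorted (pairwise_sort_lt b) (pairwise_increasingOf (hsorted i))
      (fun x hx y hy hyx => (hmem y).2 ⟨⟨i, hy⟩, hyx.trans_lt ((hmem x).1 hx).2⟩) hinit with h | h
    · exact h
    · have := h.length_le
      simp only [increasingOf, List.length_mapIdx, Finset.length_sort] at this
      lia
  obtain ⟨t, ht, hit⟩ := hw i
  have heq := hB.prefix_eq _ ⟨b, hb, rfl⟩ t ht (hprefix.trans hit)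
  have h1 := hit.length_le
  rw [← heq, length_nondecOf] at h1
  lia

theorem IsBarrier.isFront {B : Set (Finset ℕ)} (hB : IsBarrier B) : IsFront (nondecFamily B) where
  nil_mem := by
    obtain ⟨b, hb, -⟩ := hB.2 Set.univ Set.infinite_univ
    exact ⟨_, ⟨b, hb, rfl⟩, List.nil_prefix⟩
  sorted := by
    rintro _ ⟨b, -, rfl⟩
    exact pairwise_nondecOf b
  antichain := hB.prefix_eq
  extend := by
    rintro t ⟨u, hu, htu⟩ htF m hm
    have ht : t.Pairwise (· ≤ ·) := by
      obtain ⟨b, -, rfl⟩ := hu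
      exact (pairwise_nondecOf b).sublist htu.sublist
    have htm : (t ++ [m]).Pairwise (· ≤ ·) := by
      rw [List.pairwise_append]
      exact ⟨ht, List.pairwise_singleton _ _, fun x hx y hy => by
        rw [List.mem_singleton.1 hy]; exact hm x hx⟩
    obtain ⟨s, hs, h | h⟩ := hB.prefix_or_prefix htm
    · rcases List.prefix_concat_iff.1 h with h | h
      · exact ⟨s, hs, by rw [h]⟩
      · obtain rfl := hB.prefix_eq s hs u hu (h.trans htu)
        exact absurd (h.eq_of_length_le htu.length_le ▸ hs) htF
    · exact ⟨s, hs, h⟩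
  induct := by
    intro P hP w hw
    by_contra hPw
    -- Failure of the induction principle passes to a child, and iterating produces an infinite
    -- branch.
    have hstep : ∀ x : {w // w ∈ initSegs (nondecFamily B) ∧ ¬ P w},
        ∃ y : {w // w ∈ initSegs (nondecFamily B) ∧ ¬ P w}, ∃ v, y.1 = x.1 ++ [v] := by
      rintro ⟨x, hx, hPx⟩
      by_contra hne
      refine hPx (hP x hx fun _ v hv => ?_)
      by_contra hPv
      exact hne ⟨⟨_, hv, hPv⟩, v, rfl⟩
    choose next hnext using hstep
    let g : ℕ → {w // w ∈ initSegs (nondecFamily B) ∧ ¬ P w} := fun n =>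
      n.rec ⟨w, hw, hPw⟩ fun _ x => next x
    have hg : ∀ n, ∃ v, (g (n + 1)).1 = (g n).1 ++ [v] := fun n => hnext (g n)
    refine hB.not_forall_mem_initSegs (fun n => (g n).1) (fun n => (g n).2.1) (fun n => ?_) ?_
    · induction n with
      | zero => exact Nat.zero_le _
      | succ n ih =>
        obtain ⟨v, hv⟩ := hg n
        rw [hv]
        simpa using ih
    · intro i j hij
      induction j, hij using Nat.le_induction with
      | base => exact List.prefix_rfl
      | succ j _ ih =>
        obtain ⟨v, hv⟩ := hg j
        refine ih.trans ?_
        rw [hv]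
        exact List.prefix_append _ _

/-! ### Members of size at most one, and the rank -/

theorem nondecOf_eq_nil {b : Finset ℕ} (h : nondecOf b = []) : b = ∅ := by
  have := length_nondecOf b
  rw [h] at this
  exact Finset.card_eq_zero.1 this.symm

theorem nondecOf_eq_singleton {b : Finset ℕ} {n : ℕ} (h : nondecOf b = [n]) : b = {n} := by
  have h1 := increasingOf_nondecOf b
  rw [h] at h1
  ext x
  rw [← Finset.mem_sort (· ≤ ·), ← h1]
  simp [increasingOf]

theorem IsUniformOn.zero_of_empty_mem {β : Ordinal.{0}} {M : Set ℕ} {A : Set (Finset ℕ)}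
    (h : IsUniformOn β M A) (h0 : ∅ ∈ A) : β = 0 := by
  cases h with
  | zero => rfl
  | succ _ _ _ _ h => exact absurd h0 h
  | limit _ _ _ _ _ h => exact absurd h0 h

theorem IsUniformBarrier.empty_notMem {α : Ordinal.{0}} {B : Set (Finset ℕ)}
    (hB : IsUniformBarrier α B) (hα : 2 ≤ α) : ∅ ∉ B := by
  intro h
  rw [hB.2.zero_of_empty_mem h] at hα
  exact absurd hα (not_le.2 two_pos)

theorem IsUniformBarrier.finite_singleton_mem {α : Ordinal.{0}} {B : Set (Finset ℕ)}
    (hB : IsUniformBarrier α B) (hα : 2 ≤ α) : {n : ℕ | ({n} : Finset ℕ) ∈ B}.Finite := by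
  have hsec : ∀ n : ℕ, ({n} : Finset ℕ) ∈ B → ∅ ∈ familySection B n := by
    intro n hn
    exact ⟨by simp, by simpa using hn⟩
  obtain ⟨-, hu⟩ := hB
  generalize hM : (Set.univ : Set ℕ) = M at hu
  cases hu with
  | zero => exact absurd hα (not_le.2 two_pos)
  | succ β _ _ hA h0 h =>
    subst hM
    refine Set.finite_empty.subset fun n hn => ?_
    obtain rfl := (h n trivial).zero_of_empty_mem (hsec n hn)
    rw [Order.succ_eq_add_one, zero_add] at hα
    exact absurd hα (not_le.2 one_lt_two)
  | limit _ hlim _ _ hA h0 a hmono hlt hcof h =>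
    subst hM
    -- From `n₀` on the sections have positive rank, by monotonicity, and so omit `∅`.
    obtain ⟨n₀, -, hn₀⟩ := hcof 0 (two_pos.trans_le hα)
    refine (Set.finite_Iio n₀).subset fun n hn => ?_
    by_contra hle
    have h1 := hmono (Set.mem_univ n₀) (Set.mem_univ n) (not_lt.1 hle)
    rw [(h n trivial).zero_of_empty_mem (hsec n hn)] at h1
    exact absurd hn₀ (not_lt.2 h1)

/-! ### The space `𝓔₂` -/

theorem initSegs_nondecEq (k : ℕ) : initSegs (nondecEq k) = nondecLE k := by
  ext s
  constructor
  · rintro ⟨t, ⟨ht, hk⟩, h⟩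
    exact ⟨ht.sublist h.sublist, hk ▸ h.length_le⟩
  · rintro ⟨hs, hk⟩
    refine ⟨s ++ List.replicate (k - s.length) (s.getLastD 0), ⟨?_, ?_⟩, List.prefix_append _ _⟩
    · rw [List.pairwise_append]
      refine ⟨hs, List.pairwise_replicate.2 (Or.inr le_rfl), fun x hx y hy => ?_⟩
      rw [(List.mem_replicate.1 hy).2]
      exact le_getLastD_of_pairwise hs hx
    · simp [Nat.add_sub_cancel' hk]

theorem concat_mem_nondecLE {k : ℕ} {s : List ℕ} {m : ℕ} :
    s ++ [m] ∈ nondecLE k ↔ s ∈ nondecLE k ∧ s ∉ nondecEq k ∧ ∀ x ∈ s, x ≤ m := by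
  simp only [nondecLE, nondecEq, Set.mem_ofPred_eq, List.pairwise_append, List.length_append,
    List.length_singleton, List.mem_singleton, List.pairwise_singleton]
  constructor
  · rintro ⟨⟨h1, -, h2⟩, h3⟩
    exact ⟨⟨h1, by lia⟩, fun h => by lia, fun x hx => h2 x hx m rfl⟩
  · rintro ⟨⟨h1, h2⟩, h3, h4⟩
    refine ⟨⟨h1, trivial, fun x hx y hy => hy ▸ h4 x hx⟩, ?_⟩
    have : s.length ≠ k := fun h => h3 ⟨h1, h⟩
    lia

theorem isFront_nondecEq (k : ℕ) : IsFront (nondecEq k) where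
  nil_mem := by
    rw [initSegs_nondecEq]
    exact ⟨List.Pairwise.nil, Nat.zero_le _⟩
  sorted := fun _ h => h.1
  antichain := fun _ hs _ ht h => h.eq_of_length (hs.2.trans ht.2.symm)
  extend := by
    intro t ht htF m hm
    rw [initSegs_nondecEq] at ht ⊢
    exact concat_mem_nondecLE.2 ⟨ht, htF, hm⟩
  induct := by
    intro P hP
    have key : ∀ d, ∀ w ∈ initSegs (nondecEq k), k ≤ w.length + d → P w := by
      intro d
      induction d with
      | zero =>
        intro w hw hd
        refine hP w hw fun _ v hv => ?_
        rw [initSegs_nondecEq] at hv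
        have := hv.2
        simp only [List.length_append, List.length_singleton] at this
        lia
      | succ d ih =>
        intro w hw hd
        refine hP w hw fun _ v hv => ih _ hv ?_
        simp only [List.length_append, List.length_singleton]
        lia
    exact fun w hw => key k w hw (Nat.le_add_left _ _)

theorem IsETree.eq_nondecLE {k : ℕ} {D : Set (List ℕ)} {f : List ℕ → List ℕ}
    (hf : IsETree (nondecEq k) D f) : D = nondecLE k := by
  ext s
  induction s using List.reverseRecOn with
  | nil => exact iff_of_true hf.nil_mem ⟨List.Pairwise.nil, Nat.zero_le _⟩
  | append_singleton s m ih =>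
    rw [hf.concat_mem, concat_mem_nondecLE, ← ih]
    refine and_congr_right fun hs => and_congr_left fun _ => not_congr ?_
    have h1 := hf.maps s hs
    rw [initSegs_nondecEq] at h1
    have h2 := ih.1 hs
    have h3 := hf.length_eq s hs
    exact ⟨fun h => ⟨h2.1, h3.symm.trans h.2⟩, fun h => ⟨h1.1, h3.trans h.2⟩⟩

/-- Each further entry lengthens the image by at least one. With images of length at most `k`, this
forces `f` to preserve length, which `EllentuckFin` does not demand and `IsETree` does. -/
theorem length_le_of_properInit {k : ℕ} {f : List ℕ → List ℕ}
    (hf : ∀ s ∈ nondecLE k, ∀ t ∈ nondecLE k, ProperInit s t → ProperInit (f s) (f t))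
    {s u : List ℕ} (h : s ++ u ∈ nondecLE k) :
    (f s).length + u.length ≤ (f (s ++ u)).length := by
  induction u using List.reverseRecOn with
  | nil => simp
  | append_singleton u m ih =>
    rw [← List.append_assoc] at h ⊢
    have h1 := concat_mem_nondecLE.1 h
    have h2 := hf _ h1.1 _ h (properInit_concat _ _)
    have h3 : (f (s ++ u)).length < (f (s ++ u ++ [m])).length :=
      lt_of_le_of_ne h2.1.length_le fun h => h2.2 (h2.1.eq_of_length h)
    have h4 := ih h1.1
    simp only [List.length_append, List.length_singleton]
    lia

theorem ellentuckFin_eq (k : ℕ) : EllentuckFin k = EllentuckOn (nondecEq k) := by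
  ext X
  constructor
  · rintro ⟨f, hmaps, hprec, hinit, rfl⟩
    have hlen : ∀ s ∈ nondecLE k, (f s).length = s.length := by
      intro s hs
      have h1 := length_le_of_properInit hinit (s := []) (u := s) hs
      have h2 := hs
      rw [← initSegs_nondecEq] at h2
      obtain ⟨_, ht, u, rfl⟩ := h2
      have h3 : s ++ u ∈ nondecLE k := ⟨ht.1, ht.2.le⟩
      have h4 := length_le_of_properInit hinit h3
      have h5 := (hmaps _ h3).2
      have h6 := ht.2
      simp only [List.nil_append, List.length_append] at h1 h6
      lia
    have hF : ∀ s ∈ nondecLE k, (f s ∈ nondecEq k ↔ s ∈ nondecEq k) := fun s hs =>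
      ⟨fun h => ⟨hs.1, (hlen s hs).symm.trans h.2⟩,
        fun h => ⟨(hmaps s hs).1, (hlen s hs).trans h.2⟩⟩
    refine ⟨nondecLE k, f, ⟨⟨List.Pairwise.nil, Nat.zero_le _⟩, fun s m => ?_, fun s hs => ?_,
      hlen, hprec, hinit⟩, ?_⟩
    · rw [concat_mem_nondecLE]
      exact and_congr_right fun hs => and_congr_left fun _ => not_congr (hF s hs).symm
    · rw [initSegs_nondecEq]
      exact hmaps s hs
    · congr 1
      ext s
      exact ⟨fun h => ⟨⟨h.1, h.2.le⟩, (hF s ⟨h.1, h.2.le⟩).2 h⟩, fun h => (hF s h.1).1 h.2⟩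
  · rintro ⟨D, f, hf, rfl⟩
    obtain rfl := hf.eq_nondecLE
    have hmaps := hf.maps
    rw [initSegs_nondecEq] at hmaps
    refine ⟨f, hmaps, hf.prec, hf.init, ?_⟩
    congr 1
    ext s
    constructor
    · rintro ⟨h1, h2⟩
      exact ⟨h1.1, (hf.length_eq s h1).symm.trans h2.2⟩
    · intro h
      have h1 : s ∈ nondecLE k := ⟨h.1, h.2.le⟩
      exact ⟨h1, (hmaps s h1).1, (hf.length_eq s h1).trans h.2⟩

/-! ### The tower numbers -/

theorem IsFront.towerNumber_ellentuckOn {F : Set (List ℕ)} (hF : IsFront F) (h0 : [] ∉ F)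
    (h1 : {n | [n] ∈ F}.Finite) : towerNumber (EllentuckOn F) AlmostSub = Cardinal.aleph 1 :=
  towerNumber_eq_aleph_one h0 h1 hF.not_finNull (fun _ => hF.pos_of_mem_ellentuckOn)
    fun _ => hF.exists_ellentuckOn_subset

theorem towerNumber_ellentuckFin_two :
    towerNumber (EllentuckFin 2) AlmostSub = Cardinal.aleph 1 := by
  rw [ellentuckFin_eq]
  exact (isFront_nondecEq 2).towerNumber_ellentuckOn (fun h => by simpa using h.2)
    (Set.finite_empty.subset fun n h => by simpa using h.2)

theorem mainTheorem10 (α : Ordinal.{0}) (B : Set (Finset ℕ)) (hB : IsUniformBarrier α B)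
    (hα : 2 ≤ α) (hα' : α < Ordinal.omega 1) :
    towerNumber (EllentuckBarrier B) AlmostSub ≤ towerNumber (EllentuckFin 2) AlmostSub ∧
    towerNumber (EllentuckBarrier B) AlmostSub = Cardinal.aleph 1 ∧
    towerNumber (FinPositive B) AlmostSub = Cardinal.aleph 1 := by
  have hF := hB.1.isFront
  have h0 : [] ∉ nondecFamily B := by
    rintro ⟨b, hb, h⟩
    exact hB.empty_notMem hα (nondecOf_eq_nil h ▸ hb)
  have h1 : {n | [n] ∈ nondecFamily B}.Finite := by
    refine (hB.finite_singleton_mem hα).subset ?_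
    rintro n ⟨b, hb, h⟩
    obtain rfl := nondecOf_eq_singleton h
    exact hb
  have hE : towerNumber (EllentuckBarrier B) AlmostSub = Cardinal.aleph 1 :=
    hF.towerNumber_ellentuckOn h0 h1
  refine ⟨(hE.trans towerNumber_ellentuckFin_two.symm).le, hE, ?_⟩
  exact towerNumber_eq_aleph_one h0 h1 hF.not_finNull (fun _ h => h)
    fun X hX hpos => ⟨X, ⟨hX, hpos⟩, subset_rfl⟩
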